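/- Let $S_0(x)=x/2$, $S_1(x)=x/2+1/2$, $S_2(x)=-x/2+1/2$, let $p_0,p_1,p_2>0$ with $p_0+p_1+p_2=1$ and $p_1<p_0$, and let $\mu$ be the probability measure on $[0,1]$ with $$\mu=p_0\,\mu\circ S_0^{-1}+p_1\,\mu\circ S_1^{-1}+p_2\,\mu\circ S_2^{-1}.$$ Let $\nu=(\mu+\mu\circ T)/2$, where $T(x)=1-x$. For $x\in[0,1)$ let $I_n(x)$ be the dyadic interval $[k2^{-n},(k+1)2^{-n})$ containing $x$, and let $I_n(1)=[1-2^{-n},1)$. For a probability measure $m$ on $[0,1]$ and $\alpha\in\mathbb R$ let $$E_\alpha(m)=\Big\{x\in[0,1]:\ \lim_{n\to\infty}-\frac{\log m(I_n(x))}{n\log 2}=\alpha\Big\},\qquad D_m=\{\alpha\in\mathbb R:\ E_\alpha(m)\neq\emptyset\},$$ and let $$\tau_m(q)=\limsup_{n\to\infty}\frac1{n\log 2}\log\sum_I m(I)^q\qquad(q\in\mathbb R),$$ where the sum runs over the dyadic intervals $I=[k2^{-n},(k+1)2^{-n})$, $0\le k<2^n$, with $m(I)\ne0$. Let $\tau_\nu^*(\alpha)=\inf_{q\in\mathbb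 R}(\alpha q+\tau_\nu(q))$, and let $\dim$ be the Hausdorff dimension. Then $\tau_\nu$ is finite and differentiable on $\mathbb R$, the limits $\tau_\nu'(\pm\infty)=\lim_{q\to\pm\infty}\tau_\nu'(q)$ exist in $\mathbb R$, and $$D_\mu=D_\nu\cup\{-\log_2p_1\}=[-\tau_\nu'(+\infty),\,-\tau_\nu'(-\infty)]\cup\{-\log_2p_1\}.$$ Moreover $-\tau_\nu'(-\infty)<-\log_2p_1$, so $-\log_2 p_1$ is an isolated point of $D_\mu$. Finally $$\dim E_\alpha(\mu)=\tau_\nu^*(\alpha)\ \text{ if }\ \alpha\in[-\tau_\nu'(+\infty),-\tau_\nu'(-\infty)],\qquad \dim E_\alpha(\mu)=0\ \text{ if }\ \alpha=-\log_2p_1.$$ -/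

import Mathlib

open MeasureTheory Filter Topology Set
open scoped ENNReal

noncomputable section

namespace DyadicMultifractal

/-- The dyadic interval `[k / 2 ^ n, (k + 1) / 2 ^ n)` of the `n`-th generation. -/
def dyadicInterval (n k : ℕ) : Set ℝ :=
  Set.Ico ((k : ℝ) / 2 ^ n) (((k : ℝ) + 1) / 2 ^ n)

/-- The index `k` of the dyadic interval of generation `n` attached to a point `x` of `[0, 1]`:
for `x < 1` it is the unique `k` with `x ∈ [k / 2 ^ n, (k + 1) / 2 ^ n)`, and the point `x = 1`
(expansion `0.111…` in base two) is attached to the last interval, `k = 2 ^ n - 1`. -/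
def dyadicIndex (n : ℕ) (x : ℝ) : ℕ :=
  min ⌊(2 : ℝ) ^ n * x⌋₊ (2 ^ n - 1)

/-- The dyadic interval `I_n(x)` of generation `n` around `x ∈ [0, 1]`. -/
def dyadicAround (n : ℕ) (x : ℝ) : Set ℝ :=
  dyadicInterval n (dyadicIndex n x)

/-- `m` has local dimension `α` at `x`, that is `- log m(I_n(x)) / (n log 2) → α`. If some `I_n(x)`
is a null set, then the local dimension is infinite, hence different from every real `α`. -/
def HasLocalDim (m : Measure ℝ) (x α : ℝ) : Prop :=
  (∀ n : ℕ, m (dyadicAround n x) ≠ 0) ∧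
    Tendsto (fun n : ℕ => -Real.log (m (dyadicAround n x)).toReal / ((n : ℝ) * Real.log 2))
      atTop (𝓝 α)

/-- The level set `E_α(m)`. -/
def levelSet (m : Measure ℝ) (α : ℝ) : Set ℝ :=
  {x | x ∈ Set.Icc (0 : ℝ) 1 ∧ HasLocalDim m x α}

/-- The set `D_m` of the local dimensions of `m`. -/
def localDims (m : Measure ℝ) : Set ℝ :=
  {α | (levelSet m α).Nonempty}

open Classical in
/-- `τ_n(q)`: the sum runs over the dyadic intervals of generation `n` of nonzero mass. -/
def lqLevel (m : Measure ℝ) (n : ℕ) (q : ℝ) : ℝ :=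
  1 / ((n : ℝ) * Real.log 2) *
    Real.log (∑ k ∈ (Finset.range (2 ^ n)).filter (fun k => m (dyadicInterval n k) ≠ 0),
      (m (dyadicInterval n k)).toReal ^ q)

/-- The `L^q`-spectrum `τ_m(q) = limsup τ_n(q)`, with values in the extended reals. -/
def lqSpectrum (m : Measure ℝ) (q : ℝ) : EReal :=
  limsup (fun n : ℕ => ((lqLevel m n q : ℝ) : EReal)) atTop

/-- The Legendre transform `τ*(α) = inf_q (α q + τ(q))`, with values in the extended reals. -/
def legendre (τ : ℝ → ℝ) (α : ℝ) : EReal :=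
  ⨅ q : ℝ, ((α * q + τ q : ℝ) : EReal)

/-- `μ` is a probability measure on `[0, 1]` with
`μ = p₀ μ ∘ S₀⁻¹ + p₁ μ ∘ S₁⁻¹ + p₂ μ ∘ S₂⁻¹`, where `S₀ x = x / 2`, `S₁ x = x / 2 + 1 / 2` and
`S₂ x = - x / 2 + 1 / 2`. -/
structure IsSelfSimilar (p₀ p₁ p₂ : ℝ) (μ : Measure ℝ) : Prop where
  isProbabilityMeasure : IsProbabilityMeasure μ
  supported : μ (Set.Icc (0 : ℝ) 1)ᶜ = 0
  self_similar : μ =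
    ENNReal.ofReal p₀ • μ.map (fun x : ℝ => x / 2) +
    ENNReal.ofReal p₁ • μ.map (fun x : ℝ => x / 2 + 1 / 2) +
    ENNReal.ofReal p₂ • μ.map (fun x : ℝ => -x / 2 + 1 / 2)

/-- The symmetrized measure `ν = (μ + μ ∘ T) / 2`, where `T x = 1 - x`. Since `T` is an involution,
`μ ∘ T` is the image of `μ` under `T`. -/
def symmetrize (μ : Measure ℝ) : Measure ℝ :=
  (2 : ℝ≥0∞)⁻¹ • (μ + μ.map (fun x : ℝ => 1 - x))

end DyadicMultifractal

end

noncomputable section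

namespace DyadicMultifractal

/-! Prepending a binary digit to a word `w` acts linearly on the pair (μ(I_w), μ(T I_w)), by
triangular 2×2 matrices with diagonal entries p₀ and p₁. So μ(I_w) = (1,0)·M_w·(1,1)ᵗ and ν(I_w) =
(1/2,1/2)·M_w·(1,1)ᵗ (`IsSelfSimilar.measure_dyadicInterval`, `symmetrize_dyadicInterval`).

Because p₁ < p₀, a closed cone around the diagonal is invariant under both matrices
(`step_mem_cone`). It contains (1/2,1/2), the matrices contract the projective distance on it, and ν
is therefore quasi-multiplicative (`abs_log_mass_append_le`). Every step also multiplies the mass of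
a row of the cone by at least a constant `minRate` > p₁. The vector (1,0) is outside the cone. A
digit 0 moves it into the open quadrant, after which μ and ν are comparable, so local dimensions
agree at every x < 1. The point 1 has only digits 1, where μ(I_n(1)) = p₁ⁿ. Its dimension -log₂ p₁
exceeds all those of ν since `minRate` > p₁, hence the isolated point.

What remains is the multifractal formalism for ν. Quasi-multiplicativity gives the limit τ with
bounded error in the logarithm of the moment sums. Differentiability comes from a variance bound:
under the weights W^q, the variance of log W over words of length n is O(n), locally uniformly in q
(`exists_var_le`). This bounds the second differences of τ by O(h²), and a convex function with that
property has no corner. The variance bound rests on a coupling argument (`exists_drift_sub_le`).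

The upper bound for the dimension is a covering by words of prescribed mass
(`dimH_wordLevelSet_le`). For the lower bound, differentiability and a Chernoff estimate show that
there are enough such words (`eventually_card_goodWords`). Concatenating them in blocks of slowly
growing length gives an injection of [0,1) into the level set with Hölder inverse
(`exists_holder_family`), which also covers the endpoints of the spectrum. -/

/-- Admissible probability weights of the self-similar system. -/
structure Weights where
  p₀ : ℝ
  p₁ : ℝ
  p₂ : ℝ
  pos₀ : 0 < p₀
  pos₁ : 0 < p₁
  pos₂ : 0 < p₂
  sum_eq : p₀ + p₁ + p₂ = 1
  lt : p₁ < p₀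

/-! ### Digit matrices, the invariant cone and projective contraction. -/

/-- The sum of the coordinates of a row vector. -/
def tot (x : ℝ × ℝ) : ℝ := x.1 + x.2

/-- A projective distance between row vectors (the hyperbolic tangent of half of Hilbert's metric). -/
def projDist (x y : ℝ × ℝ) : ℝ :=
  |x.1 * y.2 - x.2 * y.1| / (x.1 * y.2 + x.2 * y.1)

lemma projDist_comm (x y : ℝ × ℝ) : projDist x y = projDist y x := by
  unfold projDist
  rw [abs_sub_comm]
  congr 1
  · congr 1; ring
  · ring

/-- The words of length `n` over the alphabet `Bool`. -/
def words : ℕ → Finset (List Bool)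
  | 0 => {[]}
  | n + 1 => (words n).map ⟨List.cons false, List.cons_injective⟩ ∪
      (words n).map ⟨List.cons true, List.cons_injective⟩

lemma mem_words {n : ℕ} {w : List Bool} : w ∈ words n ↔ w.length = n := by
  induction n generalizing w with
  | zero => simp [words]
  | succ n ih =>
    rcases w with _ | ⟨b, w⟩
    · simp [words]
    · cases b <;> simp [words, ih]

lemma sum_words_succ (n : ℕ) (F : List Bool → ℝ) :
    ∑ w ∈ words (n + 1), F w
      = ∑ w ∈ words n, F (false :: w) + ∑ w ∈ words n, F (true :: w) := by
  rw [words, Finset.sum_union]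
  · simp
  · rw [Finset.disjoint_left]
    intro w hw hw'
    simp only [Finset.mem_map, Function.Embedding.coeFn_mk] at hw hw'
    obtain ⟨a, -, rfl⟩ := hw
    obtain ⟨b, -, hb⟩ := hw'
    simp at hb

lemma sum_words_add (m n : ℕ) (F : List Bool → ℝ) :
    ∑ w ∈ words (m + n), F w = ∑ u ∈ words m, ∑ v ∈ words n, F (u ++ v) := by
  induction m generalizing F with
  | zero => simp [words]
  | succ m ih =>
    rw [Nat.succ_add, sum_words_succ, sum_words_succ, ih, ih]
    simp

lemma words_nonempty (n : ℕ) : (words n).Nonempty :=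
  ⟨List.replicate n true, mem_words.2 (by simp)⟩

lemma card_words (n : ℕ) : (words n).card = 2 ^ n := by
  have h : ∀ n : ℕ, ∑ w ∈ words n, (1 : ℝ) = 2 ^ n := by
    intro n
    induction n with
    | zero => simp [words]
    | succ n ih => rw [sum_words_succ, ih]; ring
  have := h n
  simp only [Finset.sum_const, nsmul_eq_mul, mul_one] at this
  exact_mod_cast this

namespace Weights

variable (P : Weights)

/-- The action of the digit matrices on row vectors. -/
def step (x : ℝ × ℝ) : Bool → ℝ × ℝ
  | false => (P.p₀ * x.1, P.p₂ * x.1 + P.p₁ * x.2)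
  | true => (P.p₁ * x.1 + P.p₂ * x.2, P.p₀ * x.2)

/-- The action of a word on row vectors. -/
def run (x : ℝ × ℝ) (w : List Bool) : ℝ × ℝ := w.foldl P.step x

/-- The total mass of the image of a row vector under a word. -/
def mass (x : ℝ × ℝ) (w : List Bool) : ℝ := tot (P.run x w)

/-- The aperture of the invariant cone. -/
def aperture : ℝ := min 1 (min ((P.p₀ - P.p₁) / P.p₂) (P.p₂ / P.p₀))

/-- A cone of row vectors that is invariant under both digit matrices. -/
def cone : Set (ℝ × ℝ) :=
  {x | 0 < x.1 ∧ 0 < x.2 ∧ P.aperture * x.2 ≤ x.1 ∧ P.aperture * x.1 ≤ x.2}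

/-- The smallest growth factor in the invariant cone. -/
def minRate : ℝ := P.p₁ + (P.p₀ + P.p₂ - P.p₁) * P.aperture / 2

/-- The contraction factor of the digit matrices on the invariant cone. -/
def contr : ℝ := P.p₁ / (P.p₁ + P.aperture * P.p₂)

lemma aperture_pos : 0 < P.aperture := by
  have := P.pos₀; have := P.pos₁; have := P.pos₂; have := sub_pos.2 P.lt
  unfold aperture; positivity

lemma aperture_le_one : P.aperture ≤ 1 := min_le_left _ _

lemma aperture_mul_p₂ : P.aperture * P.p₂ + P.p₁ ≤ P.p₀ := by
  have h : P.aperture ≤ (P.p₀ - P.p₁) / P.p₂ := (min_le_right _ _).trans (min_le_left _ _)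
  rw [le_div_iff₀ P.pos₂] at h
  linarith

lemma aperture_mul_p₀ : P.aperture * P.p₀ ≤ P.p₂ := by
  have h : P.aperture ≤ P.p₂ / P.p₀ := (min_le_right _ _).trans (min_le_right _ _)
  rwa [le_div_iff₀ P.pos₀] at h

lemma p₁_lt_minRate : P.p₁ < P.minRate := by
  have := P.aperture_pos; have := P.lt; have := P.pos₂
  have : 0 < P.p₀ + P.p₂ - P.p₁ := by linarith
  have : 0 < (P.p₀ + P.p₂ - P.p₁) * P.aperture / 2 := by positivity
  unfold minRate; linarith

lemma minRate_pos : 0 < P.minRate := P.pos₁.trans P.p₁_lt_minRate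

lemma contr_pos : 0 < P.contr := by
  have := P.aperture_pos; have := P.pos₁; have := P.pos₂
  unfold contr; positivity

lemma contr_lt_one : P.contr < 1 := by
  have := P.aperture_pos; have := P.pos₁; have := P.pos₂
  have : 0 < P.aperture * P.p₂ := by positivity
  unfold contr
  rw [div_lt_one (by positivity)]
  linarith

variable {P}

/-- The last two terms of the minimum in `aperture` are what the two cone inequalities require after
a step; the first of them is positive only because p₁ < p₀. The term 1 puts the diagonal in the
cone. -/
lemma step_mem_cone {x : ℝ × ℝ} (hx : x ∈ P.cone) (i : Bool) : P.step x i ∈ P.cone := by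
  obtain ⟨h1, h2, h3, h4⟩ := hx
  have hδ := P.aperture_pos
  have a0 := P.pos₀; have a1 := P.pos₁; have a2 := P.pos₂
  have e1 := P.aperture_mul_p₂; have e2 := P.aperture_mul_p₀
  cases i
  · refine ⟨?_, ?_, ?_, ?_⟩ <;> simp only [step]
    · positivity
    · positivity
    · nlinarith [mul_le_mul_of_nonneg_left h3 a1.le, mul_le_mul_of_nonneg_right e1 h1.le]
    · nlinarith [mul_le_mul_of_nonneg_right e2 h1.le, mul_pos a1 h2]
  · refine ⟨?_, ?_, ?_, ?_⟩ <;> simp only [step]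
    · positivity
    · positivity
    · nlinarith [mul_le_mul_of_nonneg_right e2 h2.le, mul_pos a1 h1]
    · nlinarith [mul_le_mul_of_nonneg_left h4 a1.le, mul_le_mul_of_nonneg_right e1 h2.le]

lemma tot_pos {x : ℝ × ℝ} (hx : x ∈ P.cone) : 0 < tot x := add_pos hx.1 hx.2.1

lemma fst_ge {x : ℝ × ℝ} (hx : x ∈ P.cone) : P.aperture / 2 * tot x ≤ x.1 := by
  obtain ⟨h1, h2, h3, h4⟩ := hx
  unfold tot
  nlinarith [mul_le_mul_of_nonneg_right P.aperture_le_one h1.le]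

lemma snd_ge {x : ℝ × ℝ} (hx : x ∈ P.cone) : P.aperture / 2 * tot x ≤ x.2 := by
  obtain ⟨h1, h2, h3, h4⟩ := hx
  unfold tot
  nlinarith [mul_le_mul_of_nonneg_right P.aperture_le_one h2.le]

/-- The new total is p₁ times the old one plus (p₀ + p₂ - p₁) times one coordinate, and in the cone
each coordinate is at least `aperture / 2` of the total. The strict excess over p₁ is the source of
the isolated point. -/
lemma minRate_mul_tot_le {x : ℝ × ℝ} (hx : x ∈ P.cone) (i : Bool) :
    P.minRate * tot x ≤ tot (P.step x i) := by
  have f := fst_ge hx; have g := snd_ge hx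
  have a2 := P.pos₂
  have hp : 0 ≤ P.p₀ + P.p₂ - P.p₁ := by linarith [P.lt]
  have hf := mul_le_mul_of_nonneg_left f hp
  have hg := mul_le_mul_of_nonneg_left g hp
  cases i <;> simp only [step, tot, minRate] at * <;> nlinarith

lemma tot_step_le {x : ℝ × ℝ} (hx : 0 ≤ x.1 ∧ 0 ≤ x.2) (i : Bool) :
    tot (P.step x i) ≤ tot x := by
  obtain ⟨h1, h2⟩ := hx
  have a0 := P.pos₀; have a1 := P.pos₁; have a2 := P.pos₂; have s := P.sum_eq
  have b0 : P.p₀ = 1 - P.p₁ - P.p₂ := by linarith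
  have c2 : P.p₁ ≤ 1 := by linarith
  cases i <;> simp only [step, tot] <;> rw [b0] <;>
    nlinarith [mul_le_mul_of_nonneg_right c2 h1, mul_le_mul_of_nonneg_right c2 h2,
      mul_nonneg a1.le h1, mul_nonneg a1.le h2]

lemma projDist_nonneg {x y : ℝ × ℝ} (hx : x ∈ P.cone) (hy : y ∈ P.cone) : 0 ≤ projDist x y := by
  have := hx.1; have := hx.2.1; have := hy.1; have := hy.2.1
  unfold projDist; positivity

lemma projDist_le_one {x y : ℝ × ℝ} (hx : x ∈ P.cone) (hy : y ∈ P.cone) : projDist x y ≤ 1 := by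
  have h1 := mul_pos hx.1 hy.2.1; have h2 := mul_pos hx.2.1 hy.1
  unfold projDist
  rw [div_le_one (by positivity), abs_le]
  constructor <;> linarith

/-- The numerator is a determinant, so it is multiplied by exactly p₀p₁. The denominator grows by at
least p₀(p₁ + `aperture`·p₂), where the extra term comes from the cone inequalities. -/
lemma projDist_step_le {x y : ℝ × ℝ} (hx : x ∈ P.cone) (hy : y ∈ P.cone) (i : Bool) :
    projDist (P.step x i) (P.step y i) ≤ P.contr * projDist x y := by
  have hx' := step_mem_cone hx i; have hy' := step_mem_cone hy i
  have k1 := mul_pos hx'.1 hy'.2.1; have k2 := mul_pos hx'.2.1 hy'.1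
  obtain ⟨x1, x2, x3, x4⟩ := hx
  obtain ⟨y1, y2, y3, y4⟩ := hy
  have a0 := P.pos₀; have a1 := P.pos₁; have a2 := P.pos₂; have hδ := P.aperture_pos
  have h1 := mul_pos x1 y2; have h2 := mul_pos x2 y1
  have hc : |(P.step x i).1 * (P.step y i).2 - (P.step x i).2 * (P.step y i).1|
      = P.p₀ * P.p₁ * |x.1 * y.2 - x.2 * y.1| := by
    rw [← abs_of_pos (mul_pos a0 a1), ← abs_mul]
    congr 1
    cases i <;> simp only [step] <;> ring
  have hd : P.p₀ * (P.p₁ + P.aperture * P.p₂) * (x.1 * y.2 + x.2 * y.1)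
      ≤ (P.step x i).1 * (P.step y i).2 + (P.step x i).2 * (P.step y i).1 := by
    have hp := mul_pos a0 a2
    cases i <;> simp only [step]
    · have := mul_le_mul_of_nonneg_left (mul_le_mul_of_nonneg_right x3 y1.le) hp.le
      have := mul_le_mul_of_nonneg_left (mul_le_mul_of_nonneg_left y3 x1.le) hp.le
      nlinarith
    · have := mul_le_mul_of_nonneg_left (mul_le_mul_of_nonneg_right x4 y2.le) hp.le
      have := mul_le_mul_of_nonneg_left (mul_le_mul_of_nonneg_left y4 x2.le) hp.le
      nlinarith
  unfold projDist contr
  rw [hc, div_mul_div_comm]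
  have e : P.p₁ * |x.1 * y.2 - x.2 * y.1| /
        ((P.p₁ + P.aperture * P.p₂) * (x.1 * y.2 + x.2 * y.1))
      = P.p₀ * P.p₁ * |x.1 * y.2 - x.2 * y.1| /
        (P.p₀ * (P.p₁ + P.aperture * P.p₂) * (x.1 * y.2 + x.2 * y.1)) := by
    rw [mul_assoc P.p₀, mul_assoc P.p₀, mul_div_mul_left _ _ a0.ne']
  rw [e]
  gcongr

lemma run_nil (x : ℝ × ℝ) : P.run x [] = x := rfl

lemma run_cons (x : ℝ × ℝ) (i : Bool) (w : List Bool) :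
    P.run x (i :: w) = P.run (P.step x i) w := rfl

lemma run_append (x : ℝ × ℝ) (u w : List Bool) : P.run x (u ++ w) = P.run (P.run x u) w :=
  List.foldl_append

lemma mass_nil (x : ℝ × ℝ) : P.mass x [] = tot x := rfl

lemma mass_cons (x : ℝ × ℝ) (i : Bool) (w : List Bool) :
    P.mass x (i :: w) = P.mass (P.step x i) w := rfl

lemma mass_append (x : ℝ × ℝ) (u w : List Bool) :
    P.mass x (u ++ w) = P.mass (P.run x u) w := by
  rw [mass, run_append]; rfl

lemma run_mem_cone {x : ℝ × ℝ} (hx : x ∈ P.cone) (w : List Bool) : P.run x w ∈ P.cone := by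
  induction w generalizing x with
  | nil => exact hx
  | cons i w ih => exact ih (step_mem_cone hx i)

lemma mass_pos {x : ℝ × ℝ} (hx : x ∈ P.cone) (w : List Bool) : 0 < P.mass x w :=
  tot_pos (run_mem_cone hx w)

lemma mass_le_tot {x : ℝ × ℝ} (hx : x ∈ P.cone) (w : List Bool) : P.mass x w ≤ tot x := by
  induction w generalizing x with
  | nil => exact le_rfl
  | cons i w ih => exact (ih (step_mem_cone hx i)).trans (tot_step_le ⟨hx.1.le, hx.2.1.le⟩ i)

lemma minRate_pow_mul_tot_le {x : ℝ × ℝ} (hx : x ∈ P.cone) (w : List Bool) :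
    P.minRate ^ w.length * tot x ≤ P.mass x w := by
  induction w generalizing x with
  | nil => simp [mass_nil]
  | cons i w ih =>
    have h := ih (step_mem_cone hx i)
    rw [mass_cons, List.length_cons, pow_succ, mul_assoc]
    refine le_trans ?_ h
    have := P.minRate_pos
    gcongr
    exact minRate_mul_tot_le hx i

lemma projDist_run_le {x y : ℝ × ℝ} (hx : x ∈ P.cone) (hy : y ∈ P.cone) (w : List Bool) :
    projDist (P.run x w) (P.run y w) ≤ P.contr ^ w.length * projDist x y := by
  induction w generalizing x y with
  | nil => simp [run_nil]
  | cons i w ih =>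
    refine (ih (step_mem_cone hx i) (step_mem_cone hy i)).trans ?_
    rw [List.length_cons, pow_succ, mul_assoc]
    have := P.contr_pos
    gcongr
    exact projDist_step_le hx hy i

lemma mass_eq (x : ℝ × ℝ) (w : List Bool) :
    P.mass x w = x.1 * P.mass (1, 0) w + x.2 * P.mass (0, 1) w := by
  have h : ∀ (w : List Bool) (x y : ℝ × ℝ) (s t : ℝ),
      P.mass (s * x.1 + t * y.1, s * x.2 + t * y.2) w = s * P.mass x w + t * P.mass y w := by
    intro w
    induction w with
    | nil => intro x y s t; simp only [mass_nil, tot]; ring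
    | cons i w ih =>
      intro x y s t
      rw [mass_cons, mass_cons, mass_cons, ← ih]
      congr 1
      cases i <;> simp only [step, Prod.mk.injEq] <;> constructor <;> ring
  have := h w (1, 0) (0, 1) x.1 x.2
  simpa using this

lemma mass_basis_nonneg (w : List Bool) : 0 ≤ P.mass (1, 0) w ∧ 0 ≤ P.mass (0, 1) w := by
  have a0 := P.pos₀; have a1 := P.pos₁; have a2 := P.pos₂
  have h : ∀ (w : List Bool) (x : ℝ × ℝ), 0 ≤ x.1 → 0 ≤ x.2 → 0 ≤ P.mass x w := by
    intro w
    induction w with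
    | nil => intro x h1 h2; exact add_nonneg h1 h2
    | cons i w ih =>
      intro x h1 h2
      rw [mass_cons]
      cases i <;> refine ih _ ?_ ?_ <;> simp only [step] <;> positivity
  exact ⟨h w _ (by simp) (by simp), h w _ (by simp) (by simp)⟩

/-- The row vector that represents the symmetrized measure. -/
def center : ℝ × ℝ := (1 / 2, 1 / 2)

lemma center_mem : center ∈ P.cone := by
  have := P.aperture_le_one
  refine ⟨?_, ?_, ?_, ?_⟩ <;> norm_num [center] <;> linarith

lemma tot_center : tot center = 1 := by norm_num [tot, center]

lemma mass_center (w : List Bool) :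
    P.mass center w = (P.mass (1, 0) w + P.mass (0, 1) w) / 2 := by
  rw [mass_eq]; simp only [center]; ring

lemma mass_le_two_mul {x : ℝ × ℝ} (hx : x ∈ P.cone) (w : List Bool) :
    P.mass x w ≤ 2 * tot x * P.mass center w := by
  rw [mass_eq, mass_center]
  obtain ⟨h1, h2⟩ := P.mass_basis_nonneg w
  unfold tot
  nlinarith [mul_nonneg hx.1.le h2, mul_nonneg hx.2.1.le h1]

lemma aperture_mul_le_mass {x : ℝ × ℝ} (hx : x ∈ P.cone) (w : List Bool) :
    P.aperture * tot x * P.mass center w ≤ P.mass x w := by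
  rw [mass_eq x, mass_center]
  obtain ⟨h1, h2⟩ := P.mass_basis_nonneg w
  nlinarith [mul_le_mul_of_nonneg_right (fst_ge hx) h1, mul_le_mul_of_nonneg_right (snd_ge hx) h2]

variable (P) in
/-- The quasi-multiplicativity constant of the symmetrized measure. -/
def quasi : ℝ := Real.log 2 - Real.log P.aperture

lemma quasi_nonneg : 0 ≤ P.quasi := by
  have := Real.log_nonpos P.aperture_pos.le P.aperture_le_one
  have := Real.log_nonneg (one_le_two (α := ℝ))
  unfold quasi; linarith

/-- After reading `u`, the row is still in the cone, so up to the factors `aperture` and 2 it acts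
on `w` as `center` scaled by its total mass. -/
lemma abs_log_mass_append_le (u w : List Bool) :
    |Real.log (P.mass center (u ++ w)) - Real.log (P.mass center u)
      - Real.log (P.mass center w)| ≤ P.quasi := by
  have hu := run_mem_cone (P := P) center_mem u
  have k0 := mass_pos (P := P) center_mem u
  have k1 := mass_pos (P := P) center_mem w
  have k2 := mass_pos (P := P) center_mem (u ++ w)
  have h1 := mass_le_two_mul hu w
  have h2 := aperture_mul_le_mass hu w
  rw [← mass_append] at h1 h2
  change _ ≤ 2 * P.mass center u * _ at h1
  change _ * P.mass center u * _ ≤ _ at h2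
  have hδ := P.aperture_pos
  have g1 := Real.log_le_log k2 h1
  have g2 := Real.log_le_log (by positivity) h2
  rw [Real.log_mul (by positivity) (by positivity), Real.log_mul (by positivity) (by positivity)]
    at g1 g2
  have := Real.log_nonpos P.aperture_pos.le P.aperture_le_one
  have := Real.log_nonneg (one_le_two (α := ℝ))
  rw [abs_le]; unfold quasi
  constructor <;> linarith

variable (P) in
/-- The distortion constant. -/
def distort : ℝ := 2 / P.aperture

lemma distort_pos : 0 < P.distort := by
  have := P.aperture_pos; unfold distort; positivity

/-- Bounded distortion, uniform in the length of `w`. By linearity the difference of the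
cross-multiplied masses is det(x, y) times a difference of basis masses, and log(1 + t) ≤ t
concludes. -/
lemma log_mass_sub_le {x y : ℝ × ℝ} (hx : x ∈ P.cone) (hy : y ∈ P.cone) (w : List Bool) :
    (Real.log (P.mass x w) - Real.log (tot x)) - (Real.log (P.mass y w) - Real.log (tot y))
      ≤ P.distort * projDist x y := by
  have tx := tot_pos hx; have ty := tot_pos hy
  have mx := mass_pos hx w; have my := mass_pos hy w
  have hδ := P.aperture_pos
  obtain ⟨h1, h2⟩ := P.mass_basis_nonneg w
  have x1 := hx.1; have x2 := hx.2.1; have y1 := hy.1; have y2 := hy.2.1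
  have hD := projDist_nonneg hx hy
  have key : P.mass x w * tot y ≤ (1 + P.distort * projDist x y) * (P.mass y w * tot x) := by
    have e : P.mass x w * tot y - P.mass y w * tot x
        = (x.1 * y.2 - x.2 * y.1) * (P.mass (1, 0) w - P.mass (0, 1) w) := by
      rw [mass_eq x, mass_eq y]; unfold tot; ring
    have e2 : (x.1 * y.2 - x.2 * y.1) * (P.mass (1, 0) w - P.mass (0, 1) w)
        ≤ |x.1 * y.2 - x.2 * y.1| * (2 * P.mass center w) := by
      refine (le_abs_self _).trans ?_
      rw [abs_mul]
      gcongr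
      rw [mass_center, abs_le]
      constructor <;> linarith
    have e3 : |x.1 * y.2 - x.2 * y.1| ≤ projDist x y * (tot x * tot y) := by
      have hp : 0 < x.1 * y.2 + x.2 * y.1 := by positivity
      have : |x.1 * y.2 - x.2 * y.1| = projDist x y * (x.1 * y.2 + x.2 * y.1) := by
        unfold projDist; field_simp
      rw [this]
      gcongr
      unfold tot
      nlinarith [mul_pos x1 y1, mul_pos x2 y2]
    have e4 : 2 * (tot y * P.mass center w) ≤ P.distort * P.mass y w := by
      have := aperture_mul_le_mass hy w
      unfold distort
      rw [div_mul_eq_mul_div, le_div_iff₀ hδ]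
      linarith
    have mc := mass_pos (P := P) center_mem w
    calc P.mass x w * tot y
        = P.mass y w * tot x + (P.mass x w * tot y - P.mass y w * tot x) := by ring
      _ ≤ P.mass y w * tot x + projDist x y * (tot x * tot y) * (2 * P.mass center w) := by
          rw [e]
          have := mul_le_mul_of_nonneg_right e3 (show 0 ≤ 2 * P.mass center w by positivity)
          linarith
      _ = P.mass y w * tot x + projDist x y * tot x * (2 * (tot y * P.mass center w)) := by ring
      _ ≤ P.mass y w * tot x + projDist x y * tot x * (P.distort * P.mass y w) := by gcongr
      _ = _ := by ring
  have hdp := P.distort_pos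
  have g := Real.log_le_log (by positivity) key
  rw [Real.log_mul mx.ne' ty.ne', Real.log_mul (by positivity) (by positivity),
    Real.log_mul my.ne' tx.ne'] at g
  have := Real.log_le_sub_one_of_pos (show 0 < 1 + P.distort * projDist x y by positivity)
  linarith

lemma log_mass_sub_mem {x : ℝ × ℝ} (hx : x ∈ P.cone) (w : List Bool) :
    w.length * Real.log P.minRate ≤ Real.log (P.mass x w) - Real.log (tot x) ∧
      Real.log (P.mass x w) - Real.log (tot x) ≤ 0 := by
  have tx := tot_pos hx; have mx := mass_pos hx w; have := P.minRate_pos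
  constructor
  · have g := Real.log_le_log (by positivity) (minRate_pow_mul_tot_le hx w)
    rw [Real.log_mul (by positivity) tx.ne', Real.log_pow] at g
    linarith
  · have g := Real.log_le_log mx (mass_le_tot hx w)
    linarith

lemma log_minRate_nonpos : Real.log P.minRate ≤ 0 := by
  have := log_mass_sub_mem (P := P) center_mem [true]
  simp only [List.length_singleton, Nat.cast_one, one_mul] at this
  linarith [this.1, this.2]

end Weights

/-! ### Moment sums: mean and variance of the logarithm of the mass. -/

/-- Comparison of two averages whose weights overlap in proportion `e`. -/
lemma sum_mul_sub_sum_mul_le {ι : Type*} (s : Finset ι) {p p' g g' : ι → ℝ} {e a b : ℝ}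
    (hp : ∑ i ∈ s, p i = 1) (hp' : ∑ i ∈ s, p' i = 1) (hp'0 : ∀ i ∈ s, 0 ≤ p' i)
    (he0 : 0 ≤ e) (he : ∀ i ∈ s, e * p' i ≤ p i) (ha : ∀ i ∈ s, g i - g' i ≤ a)
    (hb : ∀ i ∈ s, ∀ j ∈ s, g i - g' j ≤ b) :
    ∑ i ∈ s, p i * g i - ∑ i ∈ s, p' i * g' i ≤ e * a + (1 - e) * b := by
  -- Coupling: p splits as e·p' plus a remainder of total mass 1 - e. The common part is compared
  -- index by index, the remainder by the crude bound b.
  have h1 : ∑ i ∈ s, p' i * (g i - g' i) ≤ a := by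
    calc ∑ i ∈ s, p' i * (g i - g' i) ≤ ∑ i ∈ s, p' i * a :=
          Finset.sum_le_sum fun i hi => mul_le_mul_of_nonneg_left (ha i hi) (hp'0 i hi)
      _ = a := by rw [← Finset.sum_mul, hp', one_mul]
  have h2 : ∀ i ∈ s, g i ≤ b + ∑ j ∈ s, p' j * g' j := by
    intro i hi
    calc g i = ∑ j ∈ s, p' j * g i := by rw [← Finset.sum_mul, hp', one_mul]
      _ ≤ ∑ j ∈ s, (p' j * b + p' j * g' j) := by
          refine Finset.sum_le_sum fun j hj => ?_
          have := mul_le_mul_of_nonneg_left (hb i hi j hj) (hp'0 j hj)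
          linarith
      _ = b + ∑ j ∈ s, p' j * g' j := by
          rw [Finset.sum_add_distrib, ← Finset.sum_mul, hp', one_mul]
  have h3 : ∑ i ∈ s, (p i - e * p' i) * g i ≤ (1 - e) * (b + ∑ j ∈ s, p' j * g' j) := by
    calc ∑ i ∈ s, (p i - e * p' i) * g i
        ≤ ∑ i ∈ s, (p i - e * p' i) * (b + ∑ j ∈ s, p' j * g' j) :=
          Finset.sum_le_sum fun i hi =>
            mul_le_mul_of_nonneg_left (h2 i hi) (sub_nonneg.2 (he i hi))
      _ = _ := by
          rw [← Finset.sum_mul, Finset.sum_sub_distrib, hp, ← Finset.mul_sum, hp', mul_one]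
  have h4 := mul_le_mul_of_nonneg_left h1 he0
  have e1 : ∑ i ∈ s, p i * g i
      = ∑ i ∈ s, (p i - e * p' i) * g i + e * ∑ i ∈ s, p' i * (g i - g' i)
        + e * ∑ i ∈ s, p' i * g' i := by
    rw [Finset.mul_sum, Finset.mul_sum, ← Finset.sum_add_distrib, ← Finset.sum_add_distrib]
    refine Finset.sum_congr rfl fun i _ => ?_
    ring
  linarith

namespace Weights

variable (P : Weights)

/-- The moment sum `∑ W ^ q (log W) ^ j` over the masses `W` of the words of length `n`. -/
def moment (j n : ℕ) (q : ℝ) (x : ℝ × ℝ) : ℝ :=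
  ∑ w ∈ words n, P.mass x w ^ q * Real.log (P.mass x w) ^ j

/-- The mean of `log W` for the weights `W ^ q`. -/
def mean (n : ℕ) (q : ℝ) (x : ℝ × ℝ) : ℝ := P.moment 1 n q x / P.moment 0 n q x

/-- The variance of `log W` for the weights `W ^ q`. -/
def var (n : ℕ) (q : ℝ) (x : ℝ × ℝ) : ℝ :=
  P.moment 2 n q x / P.moment 0 n q x - P.mean n q x ^ 2

variable {P}

lemma moment_zero_pos {x : ℝ × ℝ} (hx : x ∈ P.cone) (n : ℕ) (q : ℝ) : 0 < P.moment 0 n q x := by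
  unfold moment
  refine Finset.sum_pos (fun w _ => ?_) (words_nonempty n)
  have := mass_pos hx w
  positivity

lemma moment_succ (j n : ℕ) (q : ℝ) (x : ℝ × ℝ) :
    P.moment j (n + 1) q x = P.moment j n q (P.step x false) + P.moment j n q (P.step x true) := by
  simp only [moment, sum_words_succ, mass_cons]

lemma moment_add (j m n : ℕ) (q : ℝ) (x : ℝ × ℝ) :
    P.moment j (m + n) q x = ∑ u ∈ words m, P.moment j n q (P.run x u) := by
  simp only [moment, sum_words_add, mass_append]

lemma mean_zero (q : ℝ) {x : ℝ × ℝ} (hx : x ∈ P.cone) : P.mean 0 q x = Real.log (tot x) := by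
  have := tot_pos hx
  have : tot x ^ q ≠ 0 := by positivity
  simp only [mean, moment, words, Finset.sum_singleton, mass_nil, pow_one, pow_zero, mul_one]
  field_simp

lemma moment_ratio_le {x y : ℝ × ℝ} (hx : x ∈ P.cone) (hy : y ∈ P.cone) {q R : ℝ} (hq : |q| ≤ R)
    (u : List Bool) (n : ℕ) :
    P.moment 0 n q (P.run x u) * tot y ^ q ≤
      Real.exp (R * P.distort * projDist x y) * (P.moment 0 n q (P.run y u) * tot x ^ q) := by
  unfold moment
  rw [Finset.sum_mul, Finset.sum_mul, Finset.mul_sum]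
  refine Finset.sum_le_sum fun w _ => ?_
  simp only [pow_zero, mul_one]
  rw [← mass_append, ← mass_append]
  have mx := mass_pos hx (u ++ w); have my := mass_pos hy (u ++ w)
  have tx := tot_pos hx; have ty := tot_pos hy
  rw [Real.rpow_def_of_pos mx, Real.rpow_def_of_pos my, Real.rpow_def_of_pos tx,
    Real.rpow_def_of_pos ty, ← Real.exp_add, ← Real.exp_add, ← Real.exp_add]
  apply Real.exp_le_exp.2
  have h1 := log_mass_sub_le hx hy (u ++ w)
  have h2 := log_mass_sub_le hy hx (u ++ w)
  rw [projDist_comm] at h2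
  set A := Real.log (P.mass x (u ++ w)) - Real.log (tot x)
    - (Real.log (P.mass y (u ++ w)) - Real.log (tot y)) with hA
  have h3 : |A| ≤ P.distort * projDist x y := abs_le.2 ⟨by linarith, h1⟩
  have h4 : A * q ≤ R * (P.distort * projDist x y) := by
    calc A * q ≤ |A * q| := le_abs_self _
      _ = |q| * |A| := by rw [abs_mul, mul_comm]
      _ ≤ _ := mul_le_mul hq h3 (abs_nonneg _) ((abs_nonneg _).trans hq)
  rw [hA] at h4
  linarith

/-- The weight of the prefix `u` in the moment sum of generation `|u| + n`. -/
def prefixWeight (P : Weights) (m n : ℕ) (q : ℝ) (x : ℝ × ℝ) (u : List Bool) : ℝ :=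
  P.moment 0 n q (P.run x u) / P.moment 0 (m + n) q x

lemma sum_prefixWeight {x : ℝ × ℝ} (hx : x ∈ P.cone) (m n : ℕ) (q : ℝ) :
    ∑ u ∈ words m, P.prefixWeight m n q x u = 1 := by
  unfold prefixWeight
  rw [← Finset.sum_div, ← moment_add, div_self (moment_zero_pos hx _ _).ne']

lemma prefixWeight_nonneg {x : ℝ × ℝ} (hx : x ∈ P.cone) (m n : ℕ) (q : ℝ) (u : List Bool) :
    0 ≤ P.prefixWeight m n q x u :=
  div_nonneg (moment_zero_pos (run_mem_cone hx u) _ _).le (moment_zero_pos hx _ _).le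

lemma mean_add {x : ℝ × ℝ} (hx : x ∈ P.cone) (m n : ℕ) (q : ℝ) :
    P.mean (m + n) q x = ∑ u ∈ words m, P.prefixWeight m n q x u * P.mean n q (P.run x u) := by
  unfold mean prefixWeight
  rw [moment_add 1, Finset.sum_div]
  refine Finset.sum_congr rfl fun u _ => ?_
  have := moment_zero_pos (run_mem_cone hx u) n q
  field_simp

/-- Distortion enters twice, in the numerator and in the normalization, hence the factor 2. This is
the overlap of the two prefix distributions in the coupling. -/
lemma exp_mul_prefixWeight_le {x y : ℝ × ℝ} (hx : x ∈ P.cone) (hy : y ∈ P.cone) {q R : ℝ}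
    (hq : |q| ≤ R) (m n : ℕ) (u : List Bool) :
    Real.exp (-(2 * R * P.distort * projDist x y)) * P.prefixWeight m n q y u
      ≤ P.prefixWeight m n q x u := by
  have h1 := moment_ratio_le hy hx hq u n
  have h2 := moment_ratio_le hx hy hq [] (m + n)
  rw [projDist_comm] at h1
  rw [run_nil, run_nil] at h2
  have tx := tot_pos hx; have ty := tot_pos hy
  have a1 := moment_zero_pos (run_mem_cone hx u) n q
  have a2 := moment_zero_pos (run_mem_cone hy u) n q
  have a3 := moment_zero_pos hx (m + n) q
  have a4 := moment_zero_pos hy (m + n) q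
  unfold prefixWeight
  set E := Real.exp (R * P.distort * projDist x y) with hE
  have hE0 : 0 < E := Real.exp_pos _
  have e : Real.exp (-(2 * R * P.distort * projDist x y)) = (E * E)⁻¹ := by
    rw [hE, ← Real.exp_add, ← Real.exp_neg]; congr 1; ring
  rw [e, inv_mul_le_iff₀ (by positivity), div_le_iff₀ a4]
  set a := P.moment 0 n q (P.run x u)
  set b := P.moment 0 n q (P.run y u)
  set c := P.moment 0 (m + n) q x
  set d := P.moment 0 (m + n) q y
  have hx' : 0 < tot x ^ q := by positivity
  have hy' : 0 < tot y ^ q := by positivity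
  have h3 := mul_le_mul h1 h2 (by positivity) (by positivity)
  have h4 : b * c ≤ E * E * a * d := by
    refine le_of_mul_le_mul_right ?_ (mul_pos hx' hy')
    nlinarith
  calc b = b * c / c := by field_simp
    _ ≤ E * E * a * d / c := by gcongr
    _ = _ := by ring

/-- The normalized mean. -/
def drift (P : Weights) (n : ℕ) (q : ℝ) (x : ℝ × ℝ) : ℝ := P.mean n q x - Real.log (tot x)

lemma drift_add {x : ℝ × ℝ} (hx : x ∈ P.cone) (m n : ℕ) (q : ℝ) :
    P.drift (m + n) q x = ∑ u ∈ words m, P.prefixWeight m n q x u *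
      (P.drift n q (P.run x u) + (Real.log (P.mass x u) - Real.log (tot x))) := by
  have : ∀ u ∈ words m, P.prefixWeight m n q x u *
      (P.drift n q (P.run x u) + (Real.log (P.mass x u) - Real.log (tot x)))
      = P.prefixWeight m n q x u * P.mean n q (P.run x u)
        - P.prefixWeight m n q x u * Real.log (tot x) := by
    intro u _
    have e : P.mass x u = tot (P.run x u) := rfl
    rw [drift, e]; ring
  rw [Finset.sum_congr rfl this, Finset.sum_sub_distrib, ← Finset.sum_mul, sum_prefixWeight hx,
    one_mul, ← mean_add hx, drift]

/-- One coupling step through a prefix of length `m`. On the overlap both rows read the same prefix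
and come closer by `contr ^ m`; off the overlap only the trivial bounds are available. -/
lemma drift_sub_le_step {x y : ℝ × ℝ} (hx : x ∈ P.cone) (hy : y ∈ P.cone) {q R B K : ℝ}
    (hq : |q| ≤ R) (hB : 0 ≤ B) (hK : 0 < K) (m n : ℕ)
    (h : ∀ x ∈ P.cone, ∀ y ∈ P.cone,
      P.drift n q x - P.drift n q y ≤ B * min 1 (K * projDist x y)) :
    P.drift (m + n) q x - P.drift (m + n) q y ≤
      Real.exp (-(2 * R * P.distort * projDist x y)) *
        (B * min 1 (K * (P.contr ^ m * projDist x y)) + P.distort * projDist x y)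
      + (1 - Real.exp (-(2 * R * P.distort * projDist x y))) *
        (B + m * -Real.log P.minRate) := by
  rw [drift_add hx, drift_add hy]
  refine sum_mul_sub_sum_mul_le (words m) (sum_prefixWeight hx m n q) (sum_prefixWeight hy m n q)
    (fun u _ => prefixWeight_nonneg hy m n q u) (Real.exp_pos _).le
    (fun u _ => exp_mul_prefixWeight_le hx hy hq m n u) ?_ ?_
  · intro u hu
    have h1 := h _ (run_mem_cone hx u) _ (run_mem_cone hy u)
    have h2 := log_mass_sub_le hx hy u
    have h3 := projDist_run_le hx hy u
    rw [mem_words.1 hu] at h3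
    have h4 : B * min 1 (K * projDist (P.run x u) (P.run y u))
        ≤ B * min 1 (K * (P.contr ^ m * projDist x y)) := by gcongr
    linarith
  · intro u hu w hw
    have h1 := h _ (run_mem_cone hx u) _ (run_mem_cone hy w)
    have h2 : B * min 1 (K * projDist (P.run x u) (P.run y w)) ≤ B * 1 := by
      gcongr; exact min_le_left _ _
    have h3 := (log_mass_sub_mem hx u).2
    have h4 := (log_mass_sub_mem hy w).1
    rw [mem_words.1 hw] at h4
    linarith

-- The dependence on the starting row does not accumulate with `n`. A plain bound does not propagate
-- through the coupling, but the truncated modulus B·min(1, K·D) does. For distant rows the overlap,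
-- bounded below, gives a gain; for close rows the contraction beats the lost overlap, which is at
-- most a·D.
variable (P) in
lemma exists_drift_sub_le (R : ℝ) (hR : 0 ≤ R) :
    ∃ B : ℝ, 0 ≤ B ∧ ∀ n : ℕ, ∀ q : ℝ, |q| ≤ R → ∀ x ∈ P.cone, ∀ y ∈ P.cone,
      P.drift n q x - P.drift n q y ≤ B := by
  set a := 2 * R * P.distort with ha
  have hC := P.distort_pos
  have ha0 : 0 ≤ a := by positivity
  -- K ≥ 4a makes the lost overlap a·D·B cost at most a quarter of B·K·D. `N` is then chosen so that
  -- contraction leaves at most half.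
  set K := 4 * a + 1 with hK
  have hK0 : 0 < K := by positivity
  obtain ⟨N, hN⟩ := exists_pow_lt_of_lt_one (show 0 < 1 / (2 * K) by positivity) P.contr_lt_one
  have hN0 : P.contr ^ N * K ≤ 1 / 2 := by
    have := mul_le_mul_of_nonneg_right hN.le hK0.le
    have e : 1 / (2 * K) * K = 1 / 2 := by field_simp
    linarith
  have hcN : 0 ≤ P.contr ^ N := pow_nonneg P.contr_pos.le _
  have hN1 : P.contr ^ N ≤ 1 / 2 := by
    have : P.contr ^ N * 1 ≤ P.contr ^ N * K :=
      mul_le_mul_of_nonneg_left (by linarith) hcN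
    linarith
  set c := -Real.log P.minRate with hc
  have hc0 : 0 ≤ c := by have := P.log_minRate_nonpos; linarith
  have hNpos : 0 < N := by
    rcases Nat.eq_zero_or_pos N with h | h
    · subst h; norm_num at hN1
    · exact h
  set b := Real.exp (-a) with hb
  have hb0 : 0 < b := Real.exp_pos _
  have hb1 : b ≤ 1 := Real.exp_le_one_iff.2 (by linarith)
  -- The two summands absorb the additive errors in the regimes K·D ≥ 1 and K·D < 1 respectively
  -- (`hBb` and `hBK`).
  set B := 2 * (P.distort + N * c) / b + 4 * (P.distort + a * (N * c)) / K with hB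
  have hNc : 0 ≤ (N : ℝ) * c := by positivity
  have hB0 : 0 ≤ B := by positivity
  have hBb : 2 * (P.distort + N * c) ≤ B * b := by
    have e : 2 * (P.distort + N * c) / b * b = 2 * (P.distort + N * c) := by field_simp
    have : 0 ≤ 4 * (P.distort + a * (N * c)) / K * b := by positivity
    rw [hB, add_mul, e]; linarith
  have hBK : 4 * (P.distort + a * (N * c)) ≤ B * K := by
    have e : 4 * (P.distort + a * (N * c)) / K * K = 4 * (P.distort + a * (N * c)) := by field_simp
    have : 0 ≤ 2 * (P.distort + N * c) / b * K := by positivity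
    rw [hB, add_mul, e]; linarith
  have hstep : ∀ D : ℝ, 0 ≤ D → D ≤ 1 →
      b ≤ Real.exp (-(a * D)) ∧ 1 - Real.exp (-(a * D)) ≤ a * D ∧ Real.exp (-(a * D)) ≤ 1 := by
    intro D h0 h1
    refine ⟨Real.exp_le_exp.2 ?_, ?_, Real.exp_le_one_iff.2 ?_⟩
    · nlinarith
    · linarith [Real.add_one_le_exp (-(a * D))]
    · have : 0 ≤ a * D := by positivity
      linarith
  have main : ∀ n : ℕ, ∀ q : ℝ, |q| ≤ R → ∀ x ∈ P.cone, ∀ y ∈ P.cone,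
      P.drift n q x - P.drift n q y ≤ B * min 1 (K * projDist x y) := by
    intro n
    induction n using Nat.strong_induction_on with
    | _ n ih =>
      intro q hq x hx y hy
      have hD0 := projDist_nonneg hx hy
      have hD1 := projDist_le_one hx hy
      obtain ⟨s1, s2, s3⟩ := hstep _ hD0 hD1
      set D := projDist x y
      by_cases hn : n < N
      -- For n < N the whole word serves as prefix: the drift of length 0 vanishes, so the coupling
      -- step applies with B = 0.
      · have h0 : ∀ x ∈ P.cone, ∀ y ∈ P.cone,
            P.drift 0 q x - P.drift 0 q y ≤ 0 * min 1 (K * projDist x y) := by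
          intro x hx y hy
          simp [drift, mean_zero q hx, mean_zero q hy]
        have h := drift_sub_le_step hx hy hq le_rfl hK0 n 0 h0
        rw [add_zero, ← ha] at h
        have hnN : (n : ℝ) * c ≤ N * c := by gcongr
        set e := Real.exp (-(a * D))
        have t1 : e * (P.distort * D) ≤ P.distort * D :=
          mul_le_of_le_one_left (by positivity) s3
        have t2 : (1 - e) * (n * c) ≤ (1 - e) * (N * c) :=
          mul_le_mul_of_nonneg_left hnN (by linarith)
        have t3 : (1 - e) * (N * c) ≤ a * D * (N * c) := mul_le_mul_of_nonneg_right s2 hNc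
        have t4 : (1 - e) * (N * c) ≤ 1 * (N * c) :=
          mul_le_mul_of_nonneg_right (by linarith [Real.exp_pos (-(a * D))]) hNc
        have t5 : P.distort * D ≤ P.distort := mul_le_of_le_one_right hC.le hD1
        rcases min_cases 1 (K * D) with ⟨h1, h2⟩ | ⟨h1, h2⟩ <;> rw [h1]
        · have : B * b ≤ B := mul_le_of_le_one_right hB0 hb1
          linarith
        · have := mul_le_mul_of_nonneg_right hBK hD0
          have : 0 ≤ (P.distort + a * (N * c)) * D := by positivity
          linarith
      · obtain ⟨m, rfl⟩ := Nat.exists_eq_add_of_le (not_lt.1 hn)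
        have h := drift_sub_le_step hx hy hq hB0 hK0 N m
          (fun x hx y hy => ih m (by omega) q hq x hx y hy)
        rw [← ha] at h
        set e := Real.exp (-(a * D))
        have he0 : 0 < e := Real.exp_pos _
        have t1 : e * (P.distort * D) ≤ P.distort * D :=
          mul_le_of_le_one_left (by positivity) s3
        have t3 : (1 - e) * (N * c) ≤ a * D * (N * c) := mul_le_mul_of_nonneg_right s2 hNc
        have t4 : (1 - e) * (N * c) ≤ 1 * (N * c) :=
          mul_le_mul_of_nonneg_right (by linarith) hNc
        have t5 : P.distort * D ≤ P.distort := mul_le_of_le_one_right hC.le hD1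
        have r1 : B * min 1 (K * (P.contr ^ N * D)) ≤ B * (K * (P.contr ^ N * D)) :=
          mul_le_mul_of_nonneg_left (min_le_right _ _) hB0
        have r2 : B * (K * (P.contr ^ N * D)) ≤ B * (1 / 2 * D) := by
          refine mul_le_mul_of_nonneg_left ?_ hB0
          have := mul_le_mul_of_nonneg_right hN0 hD0
          linarith
        rcases min_cases 1 (K * D) with ⟨h1, h2⟩ | ⟨h1, h2⟩ <;> rw [h1]
        · have r3 : B * (1 / 2 * D) ≤ B * (1 / 2) :=
            mul_le_mul_of_nonneg_left (by linarith) hB0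
          have r4 : e * (B * min 1 (K * (P.contr ^ N * D))) ≤ e * (B * (1 / 2)) :=
            mul_le_mul_of_nonneg_left (r1.trans (r2.trans r3)) he0.le
          have r5 : B * b ≤ B * e := mul_le_mul_of_nonneg_left s1 hB0
          linarith
        · have r3 : B * (K * (P.contr ^ N * D)) ≤ B * (K * (1 / 2 * D)) := by gcongr
          have r4 : e * (B * min 1 (K * (P.contr ^ N * D))) ≤ B * (K * (1 / 2 * D)) :=
            (mul_le_of_le_one_left (by positivity) s3).trans (r1.trans r3)
          have r5 : (1 - e) * B ≤ a * D * B := mul_le_mul_of_nonneg_right s2 hB0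
          have r6 : a * D * B ≤ K / 4 * D * B := by
            gcongr; linarith
          have r7 := mul_le_mul_of_nonneg_right hBK hD0
          linarith
  refine ⟨B, hB0, fun n q hq x hx y hy => (main n q hq x hx y hy).trans ?_⟩
  exact mul_le_of_le_one_right hB0 (min_le_left _ _)

/-- Law of total variance with respect to the first digit, multiplied by the total weight. -/
lemma var_succ {x : ℝ × ℝ} (hx : x ∈ P.cone) (n : ℕ) (q : ℝ) :
    P.var (n + 1) q x * (P.moment 0 n q (P.step x false) + P.moment 0 n q (P.step x true)) =
      P.moment 0 n q (P.step x false) * P.var n q (P.step x false)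
      + P.moment 0 n q (P.step x true) * P.var n q (P.step x true)
      + P.moment 0 n q (P.step x false) * P.moment 0 n q (P.step x true) /
        (P.moment 0 n q (P.step x false) + P.moment 0 n q (P.step x true)) *
        (P.mean n q (P.step x false) - P.mean n q (P.step x true)) ^ 2 := by
  have h0 := moment_zero_pos (step_mem_cone hx false) n q
  have h1 := moment_zero_pos (step_mem_cone hx true) n q
  simp only [var, mean, moment_succ]
  field_simp
  ring

lemma var_nonneg {x : ℝ × ℝ} (hx : x ∈ P.cone) (n : ℕ) (q : ℝ) : 0 ≤ P.var n q x := by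
  induction n generalizing x with
  | zero =>
    have := tot_pos hx
    have : tot x ^ q ≠ 0 := by positivity
    simp only [var, mean, moment, words, Finset.sum_singleton, mass_nil, pow_one, pow_zero, mul_one]
    field_simp
    simp
  | succ n ih =>
    have h0 := moment_zero_pos (step_mem_cone hx false) n q
    have h1 := moment_zero_pos (step_mem_cone hx true) n q
    have i0 := ih (step_mem_cone hx false)
    have i1 := ih (step_mem_cone hx true)
    refine nonneg_of_mul_nonneg_left ?_ (add_pos h0 h1)
    rw [var_succ hx]
    positivity

-- Each digit adds only the squared difference of two conditional means, which `exists_drift_sub_le`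
-- bounds independently of `n`.
variable (P) in
lemma exists_var_le (R : ℝ) (hR : 0 ≤ R) :
    ∃ B : ℝ, 0 ≤ B ∧ ∀ n : ℕ, ∀ q : ℝ, |q| ≤ R → ∀ x ∈ P.cone, P.var n q x ≤ n * B := by
  obtain ⟨B, hB, h⟩ := P.exists_drift_sub_le R hR
  set c := -Real.log P.minRate with hc
  have hc0 : 0 ≤ c := by have := P.log_minRate_nonpos; linarith
  refine ⟨(B + c) ^ 2, by positivity, fun n q hq => ?_⟩
  induction n with
  | zero =>
    intro x hx
    have := tot_pos hx
    have : tot x ^ q ≠ 0 := by positivity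
    simp only [var, mean, moment, words, Finset.sum_singleton, mass_nil, pow_one, pow_zero, mul_one]
    field_simp
    simp
  | succ n ih =>
    intro x hx
    have c0 := step_mem_cone hx false
    have c1 := step_mem_cone hx true
    have h0 := moment_zero_pos c0 n q
    have h1 := moment_zero_pos c1 n q
    have i0 := ih _ c0
    have i1 := ih _ c1
    have d0 := h n q hq _ c0 _ c1
    have d1 := h n q hq _ c1 _ c0
    have l0 := log_mass_sub_mem hx [false]
    have l1 := log_mass_sub_mem hx [true]
    simp only [mass_cons, mass_nil, List.length_singleton, Nat.cast_one, one_mul] at l0 l1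
    unfold drift at d0 d1
    have hm : (P.mean n q (P.step x false) - P.mean n q (P.step x true)) ^ 2 ≤ (B + c) ^ 2 := by
      rw [sq_le_sq, abs_of_nonneg (show 0 ≤ B + c by positivity), abs_le]
      constructor <;> linarith [l0.1, l0.2, l1.1, l1.2]
    refine le_of_mul_le_mul_right ?_ (add_pos h0 h1)
    rw [var_succ hx]
    set Z₀ := P.moment 0 n q (P.step x false)
    set Z₁ := P.moment 0 n q (P.step x true)
    have hz : Z₀ * Z₁ / (Z₀ + Z₁) ≤ Z₀ + Z₁ := by
      rw [div_le_iff₀ (by positivity)]; nlinarith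
    have := mul_le_mul hz hm (by positivity) (by positivity)
    have := mul_le_mul_of_nonneg_left i0 h0.le
    have := mul_le_mul_of_nonneg_left i1 h1.le
    push_cast
    linarith

lemma hasDerivAt_moment {x : ℝ × ℝ} (hx : x ∈ P.cone) (j n : ℕ) (q : ℝ) :
    HasDerivAt (fun q => P.moment j n q x) (P.moment (j + 1) n q x) q := by
  unfold moment
  refine HasDerivAt.fun_sum fun w _ => ?_
  have := (Real.hasStrictDerivAt_const_rpow (mass_pos hx w) q).hasDerivAt.mul_const
    (Real.log (P.mass x w) ^ j)
  exact this.congr_deriv (by ring)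

lemma hasDerivAt_log_moment {x : ℝ × ℝ} (hx : x ∈ P.cone) (n : ℕ) (q : ℝ) :
    HasDerivAt (fun q => Real.log (P.moment 0 n q x)) (P.mean n q x) q :=
  (hasDerivAt_moment hx 0 n q).log (moment_zero_pos hx n q).ne'

lemma hasDerivAt_mean {x : ℝ × ℝ} (hx : x ∈ P.cone) (n : ℕ) (q : ℝ) :
    HasDerivAt (fun q => P.mean n q x) (P.var n q x) q := by
  have h := moment_zero_pos hx n q
  refine ((hasDerivAt_moment hx 1 n q).div (hasDerivAt_moment hx 0 n q) h.ne').congr_deriv ?_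
  unfold var mean
  field_simp

lemma mean_mem {x : ℝ × ℝ} (hx : x ∈ P.cone) (n : ℕ) (q : ℝ) :
    n * Real.log P.minRate + Real.log (tot x) ≤ P.mean n q x ∧
      P.mean n q x ≤ Real.log (tot x) := by
  have h := moment_zero_pos hx n q
  have key : ∀ w ∈ words n, n * Real.log P.minRate + Real.log (tot x) ≤ Real.log (P.mass x w) ∧
      Real.log (P.mass x w) ≤ Real.log (tot x) := by
    intro w hw
    have := log_mass_sub_mem hx w
    rw [mem_words.1 hw] at this
    exact ⟨by linarith [this.1], by linarith [this.2]⟩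
  unfold mean
  rw [le_div_iff₀ h, div_le_iff₀ h]
  unfold moment
  simp only [pow_zero, mul_one, pow_one]
  rw [Finset.mul_sum, Finset.mul_sum]
  constructor <;> refine Finset.sum_le_sum fun w hw => ?_ <;>
    have := mass_pos hx w <;> rw [mul_comm]
  · exact mul_le_mul_of_nonneg_left (key w hw).1 (by positivity)
  · rw [mul_comm (Real.log (tot x))]
    rw [mul_comm (Real.log (P.mass x w))]
    exact mul_le_mul_of_nonneg_left (key w hw).2 (by positivity)

end Weights

/-! ### The spectrum τ: existence, convexity, differentiability, asymptotic slopes. -/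

/-- An almost additive sequence is at bounded distance from a linear one. -/
lemma exists_abs_sub_mul_le {a : ℕ → ℝ} {C : ℝ} (h : ∀ m n, |a (m + n) - a m - a n| ≤ C) :
    ∃ L : ℝ, ∀ n : ℕ, |a n - n * L| ≤ C := by
  have hC : 0 ≤ C := (abs_nonneg _).trans (h 0 0)
  have hbd : ∀ n : ℕ, |a n| ≤ n * (|a 1| + C) + C := by
    intro n
    induction n with
    | zero => have := h 0 0; simp at this; simpa using this
    | succ n ih =>
      have h1 := abs_le.1 (h n 1)
      have h2 := abs_le.1 ih
      have h3 := neg_abs_le (a 1)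
      have h4 := le_abs_self (a 1)
      push_cast
      rw [abs_le]; constructor <;> linarith [h1.1, h1.2, h2.1, h2.2]
  -- Fekete's lemma applies to both a + C and C - a. Their limits are opposite, and each bounds its
  -- sequence from below.
  have hu : Subadditive fun n => a n + C := fun m n => by
    have := (abs_le.1 (h m n)).2; linarith
  have hv : Subadditive fun n => C - a n := fun m n => by
    have := (abs_le.1 (h m n)).1; linarith
  have hbdd : ∀ b : ℕ → ℝ, (∀ n, -(n * (|a 1| + C) + C) ≤ b n) →
      BddBelow (range fun n : ℕ => b n / n) := by
    intro b hb
    refine ⟨-(|a 1| + 2 * C), ?_⟩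
    rintro _ ⟨n, rfl⟩
    rcases Nat.eq_zero_or_pos n with rfl | hn
    · simp only [Nat.cast_zero, div_zero]
      have := abs_nonneg (a 1); linarith
    · have hn' : (1 : ℝ) ≤ n := by exact_mod_cast hn
      simp only
      rw [le_div_iff₀ (by linarith)]
      have := hb n
      nlinarith
  have bu := hbdd (fun n => a n + C) fun n => by have := (abs_le.1 (hbd n)).1; linarith
  have bv := hbdd (fun n => C - a n) fun n => by have := (abs_le.1 (hbd n)).2; linarith
  have tu := hu.tendsto_lim bu
  have tv := hv.tendsto_lim bv
  have t0 : Tendsto (fun n : ℕ => (a n + C) / n + (C - a n) / n) atTop (𝓝 0) := by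
    have : (fun n : ℕ => (a n + C) / n + (C - a n) / n) = fun n : ℕ => (2 * C) / (n : ℝ) := by
      funext n; ring
    rw [this]
    exact tendsto_const_div_atTop_nhds_zero_nat _
  have e := tendsto_nhds_unique (tu.add tv) t0
  refine ⟨hu.lim, fun n => ?_⟩
  rcases Nat.eq_zero_or_pos n with rfl | hn
  · have := h 0 0; simp at this; simpa using this
  have hn' : (0 : ℝ) < n := by exact_mod_cast hn
  have h1 := hu.lim_le_div bu hn.ne'
  have h2 := hv.lim_le_div bv hn.ne'
  rw [le_div_iff₀ hn'] at h1 h2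
  have e' : hv.lim = -hu.lim := by linarith
  rw [e'] at h2
  rw [abs_le]; constructor <;> linarith

namespace Weights

variable {P : Weights}

lemma rpow_mass_append_le (q : ℝ) (u w : List Bool) :
    P.mass center (u ++ w) ^ q ≤
        Real.exp (|q| * P.quasi) * (P.mass center u ^ q * P.mass center w ^ q) ∧
      P.mass center u ^ q * P.mass center w ^ q ≤
        Real.exp (|q| * P.quasi) * P.mass center (u ++ w) ^ q := by
  have h := abs_log_mass_append_le (P := P) u w
  rw [Real.rpow_def_of_pos (mass_pos center_mem _), Real.rpow_def_of_pos (mass_pos center_mem _),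
    Real.rpow_def_of_pos (mass_pos center_mem _), ← Real.exp_add, ← Real.exp_add, ← Real.exp_add]
  set A := Real.log (P.mass center (u ++ w))
  set B := Real.log (P.mass center u)
  set C := Real.log (P.mass center w)
  have h2 : |(A - B - C) * q| ≤ |q| * P.quasi := by
    rw [abs_mul, mul_comm]; gcongr
  have h3 := abs_le.1 h2
  constructor <;> apply Real.exp_le_exp.2 <;> linarith [h3.1, h3.2]

lemma abs_log_moment_add_le (q : ℝ) (m n : ℕ) :
    |Real.log (P.moment 0 (m + n) q center) - Real.log (P.moment 0 m q center)
      - Real.log (P.moment 0 n q center)| ≤ |q| * P.quasi := by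
  have k1 := moment_zero_pos (P := P) center_mem (m + n) q
  have k2 := moment_zero_pos (P := P) center_mem m q
  have k3 := moment_zero_pos (P := P) center_mem n q
  have e : P.moment 0 m q center * P.moment 0 n q center
      = ∑ u ∈ words m, ∑ w ∈ words n, P.mass center u ^ q * P.mass center w ^ q := by
    simp only [moment, pow_zero, mul_one, Finset.sum_mul_sum]
  have e' : P.moment 0 (m + n) q center
      = ∑ u ∈ words m, ∑ w ∈ words n, P.mass center (u ++ w) ^ q := by
    simp only [moment, pow_zero, mul_one, sum_words_add]
  have h1 : P.moment 0 (m + n) q center ≤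
      Real.exp (|q| * P.quasi) * (P.moment 0 m q center * P.moment 0 n q center) := by
    rw [e, e', Finset.mul_sum]
    refine Finset.sum_le_sum fun u _ => ?_
    rw [Finset.mul_sum]
    exact Finset.sum_le_sum fun w _ => (rpow_mass_append_le q u w).1
  have h2 : P.moment 0 m q center * P.moment 0 n q center ≤
      Real.exp (|q| * P.quasi) * P.moment 0 (m + n) q center := by
    rw [e, e', Finset.mul_sum]
    refine Finset.sum_le_sum fun u _ => ?_
    rw [Finset.mul_sum]
    exact Finset.sum_le_sum fun w _ => (rpow_mass_append_le q u w).2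
  have g1 := Real.log_le_log k1 h1
  have g2 := Real.log_le_log (mul_pos k2 k3) h2
  rw [Real.log_mul (Real.exp_pos _).ne' (by positivity), Real.log_exp,
    Real.log_mul k2.ne' k3.ne'] at g1
  rw [Real.log_mul (Real.exp_pos _).ne' (by positivity), Real.log_exp,
    Real.log_mul k2.ne' k3.ne'] at g2
  rw [abs_le]; constructor <;> linarith

variable (P) in
/-- The `L^q`-spectrum of the symmetrized measure. -/
def tau (q : ℝ) : ℝ :=
  (exists_abs_sub_mul_le (a := fun n => Real.log (P.moment 0 n q center))
    (abs_log_moment_add_le q)).choose / Real.log 2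

lemma abs_log_moment_sub_le (q : ℝ) (n : ℕ) :
    |Real.log (P.moment 0 n q center) - n * (P.tau q * Real.log 2)| ≤ |q| * P.quasi := by
  have := (exists_abs_sub_mul_le (a := fun n => Real.log (P.moment 0 n q center))
    (abs_log_moment_add_le q)).choose_spec n
  have h2 : Real.log 2 ≠ 0 := (Real.log_pos one_lt_two).ne'
  rwa [tau, div_mul_cancel₀ _ h2]

lemma tendsto_log_moment_div (q : ℝ) :
    Tendsto (fun n : ℕ => Real.log (P.moment 0 n q center) / n) atTop
      (𝓝 (P.tau q * Real.log 2)) := by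
  rw [tendsto_iff_dist_tendsto_zero]
  refine squeeze_zero' (Eventually.of_forall fun _ => dist_nonneg) ?_
    (tendsto_const_div_atTop_nhds_zero_nat (|q| * P.quasi))
  filter_upwards [eventually_gt_atTop 0] with n hn
  have hn' : (0 : ℝ) < n := by exact_mod_cast hn
  rw [Real.dist_eq, le_div_iff₀ hn']
  calc _ = |Real.log (P.moment 0 n q center) / n - P.tau q * Real.log 2| * |(n : ℝ)| := by
        rw [abs_of_pos hn']
    _ = |Real.log (P.moment 0 n q center) - n * (P.tau q * Real.log 2)| := by
        rw [← abs_mul]; congr 1; field_simp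
    _ ≤ _ := abs_log_moment_sub_le q n

lemma tendsto_log_moment_div_mul (q : ℝ) :
    Tendsto (fun n : ℕ => Real.log (P.moment 0 n q center) / (n * Real.log 2)) atTop
      (𝓝 (P.tau q)) := by
  have h2 : Real.log 2 ≠ 0 := (Real.log_pos one_lt_two).ne'
  have := (tendsto_log_moment_div (P := P) q).div_const (Real.log 2)
  rw [mul_div_cancel_right₀ _ h2] at this
  simpa only [div_div] using this

lemma convexOn_log_moment (n : ℕ) :
    ConvexOn ℝ univ fun q => Real.log (P.moment 0 n q center) := by
  have h1 : deriv (fun q => Real.log (P.moment 0 n q center)) = fun q => P.mean n q center :=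
    funext fun q => (hasDerivAt_log_moment center_mem n q).deriv
  refine Monotone.convexOn_univ_of_deriv
    (fun q => (hasDerivAt_log_moment center_mem n q).differentiableAt) ?_
  rw [h1]
  refine monotone_of_deriv_nonneg (fun q => (hasDerivAt_mean center_mem n q).differentiableAt)
    fun q => ?_
  rw [(hasDerivAt_mean center_mem n q).deriv]
  exact var_nonneg center_mem n q

variable (P) in
lemma convexOn_tau : ConvexOn ℝ univ P.tau := by
  refine ⟨convex_univ, fun x _ y _ a b ha hb hab => ?_⟩
  have t1 := tendsto_log_moment_div_mul (P := P) (a • x + b • y)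
  have t2 := ((tendsto_log_moment_div_mul (P := P) x).const_mul a).add
    ((tendsto_log_moment_div_mul (P := P) y).const_mul b)
  refine le_of_tendsto_of_tendsto' t1 t2 fun n => ?_
  have := (convexOn_log_moment (P := P) n).2 (mem_univ x) (mem_univ y) ha hb hab
  have h2 := Real.log_pos one_lt_two
  rw [← mul_div_assoc, ← mul_div_assoc, ← add_div]
  exact div_le_div_of_nonneg_right this (by positivity)

-- The second derivative of log of the moment sum is the variance, at most n·B. Division by n log 2
-- makes the bound survive the limit.
variable (P) in
lemma exists_tau_second_difference_le (R : ℝ) (hR : 0 ≤ R) :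
    ∃ B : ℝ, ∀ q h : ℝ, 0 < h → |q| + h ≤ R →
      P.tau (q + h) + P.tau (q - h) - 2 * P.tau q ≤ B * h ^ 2 := by
  obtain ⟨B, hB, hv⟩ := P.exists_var_le R hR
  have h2 := Real.log_pos one_lt_two
  refine ⟨2 * B / Real.log 2, fun q h hh hq => ?_⟩
  have t := ((tendsto_log_moment_div_mul (P := P) (q + h)).add
    (tendsto_log_moment_div_mul (P := P) (q - h))).sub
    ((tendsto_log_moment_div_mul (P := P) q).const_mul 2)
  refine le_of_tendsto t ?_
  filter_upwards [eventually_gt_atTop 0] with n hn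
  have hn' : (0 : ℝ) < n := by exact_mod_cast hn
  set G := fun q => Real.log (P.moment 0 n q center) with hG
  have hd : ∀ q, HasDerivAt G (P.mean n q center) q := hasDerivAt_log_moment center_mem n
  have hd' : ∀ q, HasDerivAt (fun q => P.mean n q center) (P.var n q center) q :=
    hasDerivAt_mean center_mem n
  obtain ⟨a, ⟨a1, a2⟩, ha⟩ := exists_hasDerivAt_eq_slope G (fun q => P.mean n q center)
    (show q < q + h by linarith) (fun x _ => (hd x).continuousAt.continuousWithinAt)
    (fun x _ => hd x)
  obtain ⟨b, ⟨b1, b2⟩, hb⟩ := exists_hasDerivAt_eq_slope G (fun q => P.mean n q center)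
    (show q - h < q by linarith) (fun x _ => (hd x).continuousAt.continuousWithinAt)
    (fun x _ => hd x)
  obtain ⟨c, ⟨c1, c2⟩, hc⟩ := exists_hasDerivAt_eq_slope (fun q => P.mean n q center)
    (fun q => P.var n q center) (show b < a by linarith)
    (fun x _ => (hd' x).continuousAt.continuousWithinAt) (fun x _ => hd' x)
  have hcR : |c| ≤ R := by
    have := abs_le.1 (le_refl |q|)
    rw [abs_le]; constructor <;> linarith [this.1, this.2]
  have v1 := hv n c hcR _ center_mem
  rw [eq_div_iff (by linarith)] at ha hb hc
  have k1 : P.var n c center * (a - b) ≤ n * B * (2 * h) :=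
    mul_le_mul v1 (by linarith) (by linarith) (by positivity)
  have k2 : G (q + h) + G (q - h) - 2 * G q ≤ n * B * (2 * h) * h := by
    have := mul_le_mul_of_nonneg_right k1 hh.le
    rw [hc] at this
    nlinarith
  change G (q + h) / (n * Real.log 2) + G (q - h) / (n * Real.log 2)
    - 2 * (G q / (n * Real.log 2)) ≤ _
  have e : G (q + h) / (n * Real.log 2) + G (q - h) / (n * Real.log 2)
    - 2 * (G q / (n * Real.log 2)) = (G (q + h) + G (q - h) - 2 * G q) / (n * Real.log 2) := by
    ring
  rw [e, div_le_iff₀ (by positivity)]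
  calc _ ≤ _ := k2
    _ = _ := by field_simp

variable (P) in
lemma differentiable_tau : Differentiable ℝ P.tau := by
  intro q
  have hq : q ∈ interior (univ : Set ℝ) := by simp
  have hr := P.convexOn_tau.hasDerivWithinAt_rightDeriv_of_mem_interior hq
  have hl := P.convexOn_tau.hasDerivWithinAt_leftDeriv_of_mem_interior hq
  have hle := P.convexOn_tau.leftDeriv_le_rightDeriv_of_mem_interior hq
  obtain ⟨B, hB⟩ := P.exists_tau_second_difference_le (|q| + 1) (by positivity)
  -- By convexity the jump of the one-sided derivatives times h is at most the second difference,
  -- which is O(h²).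
  have hge : derivWithin P.tau (Ioi q) q ≤ derivWithin P.tau (Iio q) q := by
    have key : ∀ h : ℝ, 0 < h → h ≤ 1 →
        derivWithin P.tau (Ioi q) q - derivWithin P.tau (Iio q) q ≤ B * h := by
      intro h h0 h1
      have r := P.convexOn_tau.rightDeriv_le_slope_of_mem_interior hq (mem_univ (q + h))
        (by linarith)
      have l := P.convexOn_tau.slope_le_leftDeriv_of_mem_interior (mem_univ (q - h)) hq
        (by linarith)
      have s := hB q h h0 (by linarith)
      rw [slope_def_field, le_div_iff₀ (by linarith)] at r
      rw [slope_def_field, div_le_iff₀ (by linarith)] at l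
      refine le_of_mul_le_mul_right ?_ h0
      nlinarith
    have t : Tendsto (fun h : ℝ => B * h) (𝓝[>] 0) (𝓝 (B * 0)) :=
      (tendsto_id.const_mul B).mono_left nhdsWithin_le_nhds
    rw [mul_zero] at t
    have := ge_of_tendsto t (b := derivWithin P.tau (Ioi q) q - derivWithin P.tau (Iio q) q) (by
      filter_upwards [Ioc_mem_nhdsGT one_pos] with h hh
      exact key h hh.1 hh.2)
    linarith
  rw [le_antisymm hle hge] at hl
  have := hr.Ici_of_Ioi.union hl.Iic_of_Iio
  rw [union_comm, Iic_union_Ici, hasDerivWithinAt_univ] at this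
  exact this.differentiableAt

variable (P) in
lemma hasDerivAt_tau (q : ℝ) : HasDerivAt P.tau (deriv P.tau q) q :=
  (P.differentiable_tau q).hasDerivAt

variable (P) in
lemma monotone_deriv_tau : Monotone (deriv P.tau) := by
  have := P.convexOn_tau.monotoneOn_deriv fun q _ => P.differentiable_tau q
  exact monotoneOn_univ.1 this

/-- The graph of `τ` lies above its tangent lines. -/
lemma tau_ge_tangent (q r : ℝ) : P.tau q + deriv P.tau q * (r - q) ≤ P.tau r := by
  rcases lt_trichotomy q r with h | h | h
  · have := P.convexOn_tau.deriv_le_slope (mem_univ q) (mem_univ r) h (P.differentiable_tau q)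
    rw [slope_def_field, le_div_iff₀ (by linarith)] at this
    linarith
  · subst h; simp
  · have := P.convexOn_tau.slope_le_deriv (mem_univ r) (mem_univ q) h (P.differentiable_tau q)
    rw [slope_def_field, div_le_iff₀ (by linarith)] at this
    linarith

lemma tau_sub_mem {q r : ℝ} (h : q < r) :
    Real.logb 2 P.minRate * (r - q) ≤ P.tau r - P.tau q ∧ P.tau r ≤ P.tau q := by
  have h2 := Real.log_pos one_lt_two
  have t := (tendsto_log_moment_div_mul (P := P) r).sub (tendsto_log_moment_div_mul (P := P) q)
  have key : ∀ n : ℕ, 0 < n → Real.logb 2 P.minRate * (r - q)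
        ≤ Real.log (P.moment 0 n r center) / (n * Real.log 2)
          - Real.log (P.moment 0 n q center) / (n * Real.log 2) ∧
      Real.log (P.moment 0 n r center) / (n * Real.log 2)
          - Real.log (P.moment 0 n q center) / (n * Real.log 2) ≤ 0 := by
    intro n hn
    have hn' : (0 : ℝ) < n := by exact_mod_cast hn
    have hd := hasDerivAt_log_moment (P := P) center_mem n
    obtain ⟨a, -, ha⟩ := exists_hasDerivAt_eq_slope _ (fun q => P.mean n q center) h
      (fun x _ => (hd x).continuousAt.continuousWithinAt) (fun x _ => hd x)
    have hm := mean_mem (P := P) center_mem n a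
    rw [tot_center, Real.log_one, add_zero, ha, le_div_iff₀ (by linarith),
      div_le_iff₀ (by linarith)] at hm
    rw [← sub_div, le_div_iff₀ (by positivity), div_le_iff₀ (by positivity)]
    unfold Real.logb
    refine ⟨?_, by linarith [hm.2]⟩
    calc _ = n * Real.log P.minRate * (r - q) := by field_simp
      _ ≤ _ := hm.1
  constructor
  · refine ge_of_tendsto t ?_
    filter_upwards [eventually_gt_atTop 0] with n hn using (key n hn).1
  · have : P.tau r - P.tau q ≤ 0 := by
      refine le_of_tendsto t ?_
      filter_upwards [eventually_gt_atTop 0] with n hn using (key n hn).2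
    linarith

lemma deriv_tau_mem (q : ℝ) :
    Real.logb 2 P.minRate ≤ deriv P.tau q ∧ deriv P.tau q ≤ 0 := by
  have h1 := tau_sub_mem (P := P) (show q - 1 < q by linarith)
  have h2 := tau_sub_mem (P := P) (show q < q + 1 by linarith)
  have t1 := tau_ge_tangent (P := P) q (q - 1)
  have t2 := tau_ge_tangent (P := P) q (q + 1)
  constructor <;> linarith [h1.1, h1.2, h2.1, h2.2]

variable (P) in
/-- The limit of `τ'` at `+∞`. -/
def slopePos : ℝ := ⨆ q, deriv P.tau q

variable (P) in
/-- The limit of `τ'` at `-∞`. -/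
def slopeNeg : ℝ := ⨅ q, deriv P.tau q

lemma bddAbove_deriv_tau : BddAbove (range (deriv P.tau)) :=
  ⟨0, by rintro _ ⟨q, rfl⟩; exact (deriv_tau_mem q).2⟩

lemma bddBelow_deriv_tau : BddBelow (range (deriv P.tau)) :=
  ⟨_, by rintro _ ⟨q, rfl⟩; exact (deriv_tau_mem q).1⟩

lemma tendsto_deriv_tau_atTop : Tendsto (deriv P.tau) atTop (𝓝 P.slopePos) :=
  tendsto_atTop_ciSup P.monotone_deriv_tau bddAbove_deriv_tau

lemma tendsto_deriv_tau_atBot : Tendsto (deriv P.tau) atBot (𝓝 P.slopeNeg) :=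
  tendsto_atBot_ciInf P.monotone_deriv_tau bddBelow_deriv_tau

lemma deriv_tau_le_slopePos (q : ℝ) : deriv P.tau q ≤ P.slopePos := le_ciSup bddAbove_deriv_tau q

lemma slopeNeg_le_deriv_tau (q : ℝ) : P.slopeNeg ≤ deriv P.tau q := ciInf_le bddBelow_deriv_tau q

/-- The spectral gap: slopes of τ are bounded below by log₂ of `minRate`, which is strictly larger
than log₂ p₁. -/
lemma neg_slopeNeg_lt : -P.slopeNeg < -Real.logb 2 P.p₁ := by
  have h : Real.logb 2 P.minRate ≤ P.slopeNeg := le_ciInf fun q => (deriv_tau_mem q).1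
  have := Real.logb_lt_logb one_lt_two P.pos₁ P.p₁_lt_minRate
  linarith

/-- A slope whose lines through the origin stay below `τ` is in the closed range of `τ'`. -/
lemma mem_Icc_of_forall_nonneg {α : ℝ} (h : ∀ q, 0 ≤ α * q + P.tau q) :
    α ∈ Icc (-P.slopePos) (-P.slopeNeg) := by
  have hb : ∀ q, P.tau q ≤ P.tau 0 + deriv P.tau q * q := fun q => by
    have := tau_ge_tangent (P := P) q 0
    linarith
  constructor
  · by_contra! hlt
    set η := -P.slopePos - α with hη
    have hη0 : 0 < η := by linarith
    -- By convexity α·q + τ(q) ≤ τ(0) - η·q for q > 0, and this q makes the right side negative.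
    have h1 := h ((|P.tau 0| + 1) / η)
    have h2 := hb ((|P.tau 0| + 1) / η)
    have h3 := deriv_tau_le_slopePos (P := P) ((|P.tau 0| + 1) / η)
    have hq : 0 < (|P.tau 0| + 1) / η := by positivity
    set q := (|P.tau 0| + 1) / η with hqd
    have e : η * q = |P.tau 0| + 1 := by rw [hqd]; field_simp
    have := mul_le_mul_of_nonneg_right h3 hq.le
    have := le_abs_self (P.tau 0)
    rw [hη] at e
    linarith
  · by_contra! hlt
    set η := α + P.slopeNeg with hη
    have hη0 : 0 < η := by linarith
    have h1 := h (-((|P.tau 0| + 1) / η))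
    have h2 := hb (-((|P.tau 0| + 1) / η))
    have h3 := slopeNeg_le_deriv_tau (P := P) (-((|P.tau 0| + 1) / η))
    have hq : 0 < (|P.tau 0| + 1) / η := by positivity
    set q := (|P.tau 0| + 1) / η with hqd
    have e : η * q = |P.tau 0| + 1 := by rw [hqd]; field_simp
    have := mul_le_mul_of_nonneg_right h3 hq.le
    have := le_abs_self (P.tau 0)
    rw [hη] at e
    linarith

end Weights

/-! ### Binary expansions and dyadic intervals. -/

/-- The integer with a given binary expansion. -/
def idx : List Bool → ℕ
  | [] => 0
  | i :: w => (if i then 2 ^ w.length else 0) + idx w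

/-- The first binary digit of a point of `[0, 1]`. -/
def digit (x : ℝ) : Bool := decide (1 / 2 ≤ x)

/-- The doubling map of `[0, 1]`, with `1` as a fixed point. -/
def doubling (x : ℝ) : ℝ := if 1 / 2 ≤ x then 2 * x - 1 else 2 * x

/-- The first `n` binary digits of a point of `[0, 1]`. -/
def word (x : ℝ) : ℕ → List Bool
  | 0 => []
  | n + 1 => digit x :: word (doubling x) n

lemma idx_lt (w : List Bool) : idx w < 2 ^ w.length := by
  induction w with
  | nil => simp [idx]
  | cons i w ih =>
    rw [idx, List.length_cons, pow_succ]
    split_ifs <;> omega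

lemma idx_append (u w : List Bool) : idx (u ++ w) = idx u * 2 ^ w.length + idx w := by
  induction u with
  | nil => simp [idx]
  | cons i u ih =>
    rw [List.cons_append, idx, idx, ih, List.length_append, pow_add]
    split_ifs <;> ring

lemma idx_inj {u w : List Bool} (hl : u.length = w.length) (h : idx u = idx w) : u = w := by
  induction u generalizing w with
  | nil => exact (List.length_eq_zero_iff.1 hl.symm).symm
  | cons i u ih =>
    rcases w with _ | ⟨j, w⟩
    · simp at hl
    · have hl' : u.length = w.length := by simpa using hl
      have h1 := idx_lt u
      have h2 := idx_lt w
      rw [idx, idx, hl'] at h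
      rw [hl'] at h1
      cases i <;> cases j <;> simp at h
      · rw [ih hl' h]
      · omega
      · omega
      · rw [ih hl' h]

lemma sum_range_two_pow (n : ℕ) (F : ℕ → ℝ) :
    ∑ k ∈ Finset.range (2 ^ n), F k = ∑ w ∈ words n, F (idx w) := by
  induction n generalizing F with
  | zero => simp [words, idx]
  | succ n ih =>
    rw [pow_succ, mul_two, Finset.sum_range_add, sum_words_succ, ih, ih]
    congr 1
    · exact Finset.sum_congr rfl fun w _ => by simp [idx]
    · exact Finset.sum_congr rfl fun w hw => by simp [idx, mem_words.1 hw]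

lemma length_word (x : ℝ) (n : ℕ) : (word x n).length = n := by
  induction n generalizing x with
  | zero => rfl
  | succ n ih => simp [word, ih]

lemma word_mem_words (x : ℝ) (n : ℕ) : word x n ∈ words n := mem_words.2 (length_word x n)

lemma word_add (x : ℝ) (m n : ℕ) : word x (m + n) = word x m ++ word (doubling^[m] x) n := by
  induction m generalizing x with
  | zero => simp [word]
  | succ m ih => rw [Nat.succ_add, word, ih, word, Function.iterate_succ_apply, List.cons_append]

lemma doubling_mem_Ico {x : ℝ} (hx : x ∈ Ico (0 : ℝ) 1) : doubling x ∈ Ico (0 : ℝ) 1 := by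
  unfold doubling
  split_ifs with h
  · constructor <;> linarith [hx.1, hx.2]
  · constructor <;> linarith [hx.1, hx.2, not_le.1 h]

lemma idx_word_mem {x : ℝ} (hx : x ∈ Ico (0 : ℝ) 1) (n : ℕ) :
    (idx (word x n) : ℝ) ≤ 2 ^ n * x ∧ 2 ^ n * x < idx (word x n) + 1 := by
  induction n generalizing x with
  | zero => simpa [word, idx] using hx
  | succ n ih =>
    obtain ⟨h1, h2⟩ := ih (doubling_mem_Ico hx)
    rw [word, idx, length_word]
    unfold doubling at *
    unfold digit
    split_ifs at * with h <;> simp at * <;> rw [pow_succ] <;> constructor <;>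
      linarith [h]

lemma idx_word_eq_iff {x : ℝ} (hx : x ∈ Ico (0 : ℝ) 1) (n k : ℕ) :
    idx (word x n) = k ↔ (k : ℝ) ≤ 2 ^ n * x ∧ 2 ^ n * x < k + 1 := by
  have h := idx_word_mem hx n
  constructor
  · rintro rfl; exact h
  · rintro ⟨h1, h2⟩
    have a : (idx (word x n) : ℝ) < k + 1 := by linarith
    have b : (k : ℝ) < idx (word x n) + 1 := by linarith
    norm_cast at a b
    omega

lemma doubling_one : doubling 1 = 1 := by norm_num [doubling]

lemma word_one (n : ℕ) : word 1 n = List.replicate n true := by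
  induction n with
  | zero => rfl
  | succ n ih => rw [word, doubling_one, ih, List.replicate_succ]; norm_num [digit]

lemma idx_replicate_true (n : ℕ) : idx (List.replicate n true) = 2 ^ n - 1 := by
  induction n with
  | zero => rfl
  | succ n ih =>
    have := Nat.one_le_two_pow (n := n)
    rw [List.replicate_succ, idx, ih, List.length_replicate, pow_succ]
    simp only [if_true]
    omega

lemma dyadicIndex_eq {x : ℝ} (hx : x ∈ Icc (0 : ℝ) 1) (n : ℕ) :
    dyadicIndex n x = idx (word x n) := by
  unfold dyadicIndex
  rcases hx.2.eq_or_lt with rfl | h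
  · rw [word_one, idx_replicate_true, mul_one]
    have : ⌊(2 : ℝ) ^ n⌋₊ = 2 ^ n := by exact_mod_cast Nat.floor_natCast (2 ^ n)
    rw [this]; simp
  · have hm := idx_word_mem ⟨hx.1, h⟩ n
    have h0 : 0 ≤ (2 : ℝ) ^ n * x := mul_nonneg (by positivity) hx.1
    have : ⌊(2 : ℝ) ^ n * x⌋₊ = idx (word x n) := (Nat.floor_eq_iff h0).2 hm
    have hl := idx_lt (word x n)
    rw [length_word] at hl
    rw [this]
    omega

lemma exists_false_mem_word {x : ℝ} (hx : x ∈ Ico (0 : ℝ) 1) : ∃ n, false ∈ word x n := by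
  obtain ⟨n, hn⟩ := pow_unbounded_of_one_lt (1 / (1 - x)) one_lt_two
  refine ⟨n, ?_⟩
  by_contra hf
  have hw : word x n = List.replicate n true := by
    refine List.eq_replicate_iff.2 ⟨length_word x n, fun b hb => ?_⟩
    cases b
    · exact absurd hb hf
    · rfl
  have h1 := (idx_word_mem hx n).1
  rw [hw, idx_replicate_true, Nat.cast_sub Nat.one_le_two_pow] at h1
  rw [div_lt_iff₀ (by linarith [hx.2])] at hn
  push_cast at h1
  linarith

lemma mem_dyadicInterval {n k : ℕ} {x : ℝ} :
    x ∈ dyadicInterval n k ↔ (k : ℝ) ≤ x * 2 ^ n ∧ x * 2 ^ n < k + 1 := by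
  rw [dyadicInterval, mem_Ico, div_le_iff₀ (by positivity), lt_div_iff₀ (by positivity)]

lemma measurableSet_dyadicInterval (n k : ℕ) : MeasurableSet (dyadicInterval n k) :=
  measurableSet_Ico

/-! ### Masses of dyadic intervals under μ and ν. -/

namespace Weights

variable {P : Weights}

lemma mass_false (w : List Bool) :
    P.mass (1, 0) (false :: w) = P.p₀ * P.mass (1, 0) w + P.p₂ * P.mass (0, 1) w ∧
      P.mass (0, 1) (false :: w) = P.p₁ * P.mass (0, 1) w := by
  rw [mass_cons, mass_cons, mass_eq, mass_eq (P.step (0, 1) false)]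
  simp [step]

lemma mass_true (w : List Bool) :
    P.mass (1, 0) (true :: w) = P.p₁ * P.mass (1, 0) w ∧
      P.mass (0, 1) (true :: w) = P.p₂ * P.mass (1, 0) w + P.p₀ * P.mass (0, 1) w := by
  rw [mass_cons, mass_cons, mass_eq, mass_eq (P.step (0, 1) true)]
  simp [step]

lemma mass_left_pos (w : List Bool) : 0 < P.mass (1, 0) w := by
  have a0 := P.pos₀; have a1 := P.pos₁; have a2 := P.pos₂
  have h : ∀ (w : List Bool) (x : ℝ × ℝ), 0 < x.1 → 0 ≤ x.2 → 0 < P.mass x w := by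
    intro w
    induction w with
    | nil => intro x h1 h2; exact add_pos_of_pos_of_nonneg h1 h2
    | cons i w ih =>
      intro x h1 h2
      rw [mass_cons]
      cases i <;> refine ih _ ?_ ?_ <;> simp only [step] <;> positivity
  exact h w _ (by simp) (by simp)

lemma run_pos_of_mem {w : List Bool} (hw : false ∈ w) {x : ℝ × ℝ} (h1 : 0 < x.1) (h2 : 0 ≤ x.2) :
    0 < (P.run x w).1 ∧ 0 < (P.run x w).2 := by
  have a0 := P.pos₀; have a1 := P.pos₁; have a2 := P.pos₂
  have key : ∀ (w : List Bool) (x : ℝ × ℝ), 0 < x.1 → 0 < x.2 →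
      0 < (P.run x w).1 ∧ 0 < (P.run x w).2 := by
    intro w
    induction w with
    | nil => intro x h1 h2; exact ⟨h1, h2⟩
    | cons i w ih =>
      intro x h1 h2
      rw [run_cons]
      cases i <;> refine ih _ ?_ ?_ <;> simp only [step] <;> positivity
  induction w generalizing x with
  | nil => simp at hw
  | cons i w ih =>
    rw [run_cons]
    cases i
    · refine key _ _ ?_ ?_ <;> simp only [step] <;> positivity
    · refine ih (by simpa using hw) ?_ ?_ <;> simp only [step] <;> positivity

end Weights

section Measures

variable {P : Weights} {μ : Measure ℝ}

lemma IsSelfSimilar.apply_eq (hμ : IsSelfSimilar P.p₀ P.p₁ P.p₂ μ) {A : Set ℝ}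
    (hA : MeasurableSet A) :
    μ A = ENNReal.ofReal P.p₀ * μ {x | x / 2 ∈ A} + ENNReal.ofReal P.p₁ * μ {x | x / 2 + 1 / 2 ∈ A}
      + ENNReal.ofReal P.p₂ * μ {x | -x / 2 + 1 / 2 ∈ A} := by
  conv_lhs => rw [hμ.self_similar]
  simp only [Measure.add_apply, Measure.smul_apply, smul_eq_mul]
  rw [Measure.map_apply (by fun_prop) hA, Measure.map_apply (by fun_prop) hA,
    Measure.map_apply (by fun_prop) hA]
  rfl

lemma eq_zero_of_eq_ofReal_mul {a : ℝ≥0∞} {p : ℝ} (ha : a ≠ ∞) (hp0 : 0 ≤ p) (hp : p < 1)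
    (h : a = ENNReal.ofReal p * a) : a = 0 := by
  have h' := congrArg ENNReal.toReal h
  rw [ENNReal.toReal_mul, ENNReal.toReal_ofReal hp0] at h'
  have : a.toReal = 0 := by
    have : (1 - p) * a.toReal = 0 := by linarith
    rcases mul_eq_zero.1 this with h | h
    · linarith
    · exact h
  exact ((ENNReal.toReal_eq_zero_iff a).1 this).resolve_right ha

/-- Self-similarity gives μ{1} = p₁μ{1}, and then μ{0} = p₀μ{0}. Without endpoint masses, half-open
intervals and their reflections can be treated alike. -/
lemma IsSelfSimilar.measure_compl_Ioo (hμ : IsSelfSimilar P.p₀ P.p₁ P.p₂ μ) :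
    μ (Ioo (0 : ℝ) 1)ᶜ = 0 := by
  have := hμ.isProbabilityMeasure
  have hout : ∀ A : Set ℝ, A ⊆ (Icc (0 : ℝ) 1)ᶜ → μ A = 0 := fun A hA =>
    measure_mono_null hA hμ.supported
  have a0 := P.pos₀; have a1 := P.pos₁; have a2 := P.pos₂; have s := P.sum_eq
  have h1 : μ {1} = 0 := by
    refine eq_zero_of_eq_ofReal_mul (measure_ne_top μ _) a1.le (by linarith) ?_
    conv_lhs => rw [hμ.apply_eq (measurableSet_singleton 1)]
    rw [hout {x | x / 2 ∈ ({1} : Set ℝ)}, hout {x | -x / 2 + 1 / 2 ∈ ({1} : Set ℝ)}]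
    · have : {x : ℝ | x / 2 + 1 / 2 ∈ ({1} : Set ℝ)} = {1} := by
        ext x; simp only [mem_ofPred_eq, mem_singleton_iff]; constructor <;> intro h <;> linarith
      rw [this]; simp
    · intro x hx hx'
      simp only [mem_ofPred_eq, mem_singleton_iff] at hx
      linarith [hx'.1]
    · intro x hx hx'
      simp only [mem_ofPred_eq, mem_singleton_iff] at hx
      linarith [hx'.2]
  have h0 : μ {0} = 0 := by
    refine eq_zero_of_eq_ofReal_mul (measure_ne_top μ _) a0.le (by linarith) ?_
    conv_lhs => rw [hμ.apply_eq (measurableSet_singleton 0)]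
    have e0 : {x : ℝ | x / 2 ∈ ({0} : Set ℝ)} = {0} := by
      ext x; simp only [mem_ofPred_eq, mem_singleton_iff]; constructor <;> intro h <;> linarith
    have e2 : {x : ℝ | -x / 2 + 1 / 2 ∈ ({0} : Set ℝ)} = {1} := by
      ext x; simp only [mem_ofPred_eq, mem_singleton_iff]; constructor <;> intro h <;> linarith
    rw [hout {x | x / 2 + 1 / 2 ∈ ({0} : Set ℝ)}, e0, e2, h1]
    · simp
    · intro x hx hx'
      simp only [mem_ofPred_eq, mem_singleton_iff] at hx
      linarith [hx'.1]
  refine measure_mono_null (t := (Icc (0 : ℝ) 1)ᶜ ∪ ({0} ∪ {1})) ?_ ?_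
  · intro x hx
    by_contra hc
    simp only [mem_union, mem_compl_iff, mem_Icc, mem_singleton_iff, not_or, not_not] at hc
    exact hx ⟨lt_of_le_of_ne hc.1.1 (Ne.symm hc.2.1), lt_of_le_of_ne hc.1.2 hc.2.2⟩
  · rw [measure_union_null_iff, measure_union_null_iff]
    exact ⟨hμ.supported, h0, h1⟩

/-- Induction on the first digit. The preimage of an interval or of its reflection under each of the
three maps is the interval of the remaining word, the reflection of that interval, or disjoint from
(0,1). The coefficients are those of the digit matrices. -/
lemma IsSelfSimilar.measure_dyadicInterval (hμ : IsSelfSimilar P.p₀ P.p₁ P.p₂ μ) (w : List Bool) :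
    μ (dyadicInterval w.length (idx w)) = ENNReal.ofReal (P.mass (1, 0) w) ∧
      μ {x | 1 - x ∈ dyadicInterval w.length (idx w)} = ENNReal.ofReal (P.mass (0, 1) w) := by
  have := hμ.isProbabilityMeasure
  have hnull : ∀ A : Set ℝ, (∀ x ∈ A, 0 < x → x < 1 → False) → μ A = 0 := fun A hA =>
    measure_mono_null
      (show A ⊆ (Ioo (0 : ℝ) 1)ᶜ from fun x hx hx' => hA x hx hx'.1 hx'.2) hμ.measure_compl_Ioo
  have hmeas : ∀ n k, MeasurableSet {x : ℝ | 1 - x ∈ dyadicInterval n k} := fun n k =>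
    (measurable_const.sub measurable_id) (measurableSet_dyadicInterval n k)
  have a0 := P.pos₀; have a1 := P.pos₁; have a2 := P.pos₂
  induction w with
  | nil =>
    have hfull : ∀ A : Set ℝ, MeasurableSet A → (∀ x, 0 < x → x < 1 → x ∈ A) → μ A = 1 := by
      intro A hA h
      rw [← prob_compl_eq_zero_iff hA]
      exact hnull _ fun x hx h0 h1 => hx (h x h0 h1)
    simp only [List.length_nil, idx, Weights.mass_nil, tot, add_zero, zero_add, ENNReal.ofReal_one]
    refine ⟨hfull _ (measurableSet_dyadicInterval _ _) fun x h0 h1 => ?_,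
      hfull _ (hmeas _ _) fun x h0 h1 => ?_⟩
    · rw [mem_dyadicInterval]; simp; exact ⟨h0.le, h1⟩
    · rw [mem_ofPred_eq, mem_dyadicInterval]; simp; exact ⟨h1.le, h0⟩
  | cons i w ih =>
    obtain ⟨b1, b2⟩ := P.mass_basis_nonneg w
    obtain ⟨ih1, ih2⟩ := ih
    have hk : (idx w : ℝ) + 1 ≤ 2 ^ w.length := by exact_mod_cast idx_lt w
    have hk0 : (0 : ℝ) ≤ idx w := Nat.cast_nonneg _
    have hN : (0 : ℝ) < 2 ^ w.length := by positivity
    rw [hμ.apply_eq (measurableSet_dyadicInterval _ _), hμ.apply_eq (hmeas _ _)]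
    simp only [mem_ofPred_eq]
    have heq : ∀ (n k : ℕ) (f g : ℝ → ℝ), (∀ x, f x * 2 ^ (w.length + 1) - k
        = g x * 2 ^ w.length - idx w) → {x | f x ∈ dyadicInterval (w.length + 1) k}
        = {x | g x ∈ dyadicInterval w.length (idx w)} := by
      intro n k f g h
      ext x
      simp only [mem_ofPred_eq, mem_dyadicInterval]
      have := h x
      constructor <;> rintro ⟨h1, h2⟩ <;> constructor <;> linarith
    cases i
    · rw [(Weights.mass_false w).1, (Weights.mass_false w).2]
      simp only [List.length_cons, idx, Bool.false_eq_true, if_false, zero_add]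
      rw [heq 0 (idx w) (fun x => x / 2) (fun x => x) (fun x => by ring),
        heq 0 (idx w) (fun x => -x / 2 + 1 / 2) (fun x => 1 - x) (fun x => by ring),
        heq 0 (idx w) (fun x => 1 - (x / 2 + 1 / 2)) (fun x => 1 - x) (fun x => by ring),
        hnull {x | x / 2 + 1 / 2 ∈ dyadicInterval (w.length + 1) (idx w)},
        hnull {x | 1 - x / 2 ∈ dyadicInterval (w.length + 1) (idx w)},
        hnull {x | 1 - (-x / 2 + 1 / 2) ∈ dyadicInterval (w.length + 1) (idx w)},
        ofPred_mem_eq, ih1, ih2]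
      · rw [ENNReal.ofReal_add (by positivity) (by positivity), ENNReal.ofReal_mul a0.le,
          ENNReal.ofReal_mul a2.le, ENNReal.ofReal_mul a1.le]
        simp
      · intro x hx h0 h1
        rw [mem_ofPred_eq, mem_dyadicInterval, pow_succ] at hx
        have := mul_pos h0 hN
        linarith [hx.2]
      · intro x hx h0 h1
        rw [mem_ofPred_eq, mem_dyadicInterval, pow_succ] at hx
        have := mul_lt_mul_of_pos_right h1 hN
        linarith [hx.2]
      · intro x hx h0 h1
        rw [mem_ofPred_eq, mem_dyadicInterval, pow_succ] at hx
        have := mul_pos h0 hN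
        linarith [hx.2]
    · rw [(Weights.mass_true w).1, (Weights.mass_true w).2]
      simp only [List.length_cons, idx, if_true]
      have hc : ((2 ^ w.length + idx w : ℕ) : ℝ) = 2 ^ w.length + idx w := by push_cast; ring
      rw [heq 0 _ (fun x => x / 2 + 1 / 2) (fun x => x) (fun x => by rw [hc]; ring),
        heq 0 _ (fun x => 1 - x / 2) (fun x => 1 - x) (fun x => by rw [hc]; ring),
        heq 0 _ (fun x => 1 - (-x / 2 + 1 / 2)) (fun x => x) (fun x => by rw [hc]; ring),
        hnull {x | x / 2 ∈ dyadicInterval (w.length + 1) _},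
        hnull {x | -x / 2 + 1 / 2 ∈ dyadicInterval (w.length + 1) _},
        hnull {x | 1 - (x / 2 + 1 / 2) ∈ dyadicInterval (w.length + 1) _},
        ofPred_mem_eq, ih1, ih2]
      · rw [ENNReal.ofReal_add (by positivity) (by positivity), ENNReal.ofReal_mul a0.le,
          ENNReal.ofReal_mul a2.le, ENNReal.ofReal_mul a1.le]
        simp [add_comm]
      · intro x hx h0 h1
        rw [mem_ofPred_eq, mem_dyadicInterval, pow_succ, hc] at hx
        have := mul_pos h0 hN
        linarith [hx.1]
      · intro x hx h0 h1
        rw [mem_ofPred_eq, mem_dyadicInterval, pow_succ, hc] at hx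
        have := mul_pos h0 hN
        linarith [hx.1]
      · intro x hx h0 h1
        rw [mem_ofPred_eq, mem_dyadicInterval, pow_succ, hc] at hx
        have := mul_lt_mul_of_pos_right h1 hN
        linarith [hx.1]

lemma IsSelfSimilar.symmetrize_dyadicInterval (hμ : IsSelfSimilar P.p₀ P.p₁ P.p₂ μ)
    (w : List Bool) :
    symmetrize μ (dyadicInterval w.length (idx w)) = ENNReal.ofReal (P.mass Weights.center w) := by
  obtain ⟨h1, h2⟩ := hμ.measure_dyadicInterval w
  obtain ⟨b1, b2⟩ := P.mass_basis_nonneg w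
  unfold symmetrize
  rw [Measure.smul_apply, Measure.add_apply, Measure.map_apply (by fun_prop)
    (measurableSet_dyadicInterval _ _)]
  change _ • (_ + μ {x | 1 - x ∈ _}) = _
  rw [h1, h2, ← ENNReal.ofReal_add b1 b2, Weights.mass_center, smul_eq_mul, div_eq_inv_mul,
    ENNReal.ofReal_mul (by positivity), ENNReal.ofReal_inv_of_pos two_pos]
  simp

lemma IsSelfSimilar.lqLevel_symmetrize (hμ : IsSelfSimilar P.p₀ P.p₁ P.p₂ μ) (n : ℕ) (q : ℝ) :
    lqLevel (symmetrize μ) n q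
      = Real.log (P.moment 0 n q Weights.center) / (n * Real.log 2) := by
  classical
  have hw : ∀ w ∈ words n, symmetrize μ (dyadicInterval n (idx w))
      = ENNReal.ofReal (P.mass Weights.center w) := by
    intro w hw
    have := hμ.symmetrize_dyadicInterval w
    rwa [mem_words.1 hw] at this
  have e : ∑ k ∈ (Finset.range (2 ^ n)).filter
        (fun k => symmetrize μ (dyadicInterval n k) ≠ 0),
        (symmetrize μ (dyadicInterval n k)).toReal ^ q = P.moment 0 n q Weights.center := by
    rw [Finset.sum_filter, sum_range_two_pow]
    unfold Weights.moment
    refine Finset.sum_congr rfl fun w h => ?_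
    have hp := Weights.mass_pos (P := P) Weights.center_mem w
    rw [hw w h, if_pos (by simpa using hp), ENNReal.toReal_ofReal hp.le, pow_zero, mul_one]
  unfold lqLevel
  rw [e, one_div_mul_eq_div]

lemma IsSelfSimilar.lqSpectrum_symmetrize (hμ : IsSelfSimilar P.p₀ P.p₁ P.p₂ μ) (q : ℝ) :
    lqSpectrum (symmetrize μ) q = ((P.tau q : ℝ) : EReal) := by
  unfold lqSpectrum
  simp only [hμ.lqLevel_symmetrize]
  exact ((continuous_coe_real_ereal.tendsto _).comp
    (Weights.tendsto_log_moment_div_mul q)).limsup_eq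

lemma IsSelfSimilar.hasLocalDim_symmetrize_iff (hμ : IsSelfSimilar P.p₀ P.p₁ P.p₂ μ) {x α : ℝ}
    (hx : x ∈ Icc (0 : ℝ) 1) :
    HasLocalDim (symmetrize μ) x α ↔
      Tendsto (fun n : ℕ => -Real.log (P.mass Weights.center (word x n)) / (n * Real.log 2))
        atTop (𝓝 α) := by
  have h : ∀ n, symmetrize μ (dyadicAround n x)
      = ENNReal.ofReal (P.mass Weights.center (word x n)) := by
    intro n
    have := hμ.symmetrize_dyadicInterval (word x n)
    rwa [length_word, ← dyadicIndex_eq hx] at this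
  have hp := fun n => Weights.mass_pos (P := P) Weights.center_mem (word x n)
  unfold HasLocalDim
  simp only [h, ENNReal.toReal_ofReal (hp _).le]
  exact and_iff_right fun n => by simpa using hp n

lemma IsSelfSimilar.hasLocalDim_iff (hμ : IsSelfSimilar P.p₀ P.p₁ P.p₂ μ) {x α : ℝ}
    (hx : x ∈ Icc (0 : ℝ) 1) :
    HasLocalDim μ x α ↔
      Tendsto (fun n : ℕ => -Real.log (P.mass (1, 0) (word x n)) / (n * Real.log 2))
        atTop (𝓝 α) := by
  have h : ∀ n, μ (dyadicAround n x) = ENNReal.ofReal (P.mass (1, 0) (word x n)) := by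
    intro n
    have := (hμ.measure_dyadicInterval (word x n)).1
    rwa [length_word, ← dyadicIndex_eq hx] at this
  have hp := fun n => Weights.mass_left_pos (P := P) (word x n)
  unfold HasLocalDim
  simp only [h, ENNReal.toReal_ofReal (hp _).le]
  exact and_iff_right fun n => by simpa using hp n

/-- The expansion of x < 1 contains a digit 0, after which the row started at (1,0) has two positive
coordinates. From then on the masses of μ and ν differ by a constant factor depending on x. -/
lemma Weights.exists_abs_log_mass_sub_le (P : Weights) {x : ℝ} (hx : x ∈ Ico (0 : ℝ) 1) :
    ∃ C : ℝ, ∀ᶠ n in atTop, |Real.log (P.mass (1, 0) (word x n))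
      - Real.log (P.mass center (word x n))| ≤ C := by
  obtain ⟨K, hK⟩ := exists_false_mem_word hx
  obtain ⟨r1, r2⟩ := run_pos_of_mem (P := P) hK (x := (1, 0)) (by simp) (by simp)
  set r := P.run (1, 0) (word x K) with hr
  set c := min r.1 r.2
  have hc : 0 < c := lt_min r1 r2
  refine ⟨Real.log 2 + |Real.log c|, ?_⟩
  filter_upwards [eventually_ge_atTop K] with n hn
  obtain ⟨m, rfl⟩ := Nat.exists_eq_add_of_le hn
  have m1 := mass_left_pos (P := P) (word x (K + m))
  have m2 := mass_pos (P := P) center_mem (word x (K + m))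
  obtain ⟨b1, b2⟩ := P.mass_basis_nonneg (word x (K + m))
  have up : P.mass (1, 0) (word x (K + m)) ≤ 2 * P.mass center (word x (K + m)) := by
    rw [mass_center]; linarith
  have low : c * P.mass center (word x (K + m)) ≤ P.mass (1, 0) (word x (K + m)) := by
    rw [word_add, mass_append, mass_append, ← hr]
    set w := word (doubling^[K] x) m
    obtain ⟨b1, b2⟩ := P.mass_basis_nonneg w
    have hcen := run_mem_cone (P := P) center_mem (word x K)
    have h1 := mass_le_two_mul hcen w
    have h2 : tot (P.run center (word x K)) ≤ 1 :=
      (mass_le_tot center_mem (word x K)).trans_eq tot_center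
    have h3 := mass_pos (P := P) center_mem w
    have h4 : P.mass (P.run center (word x K)) w ≤ 2 * P.mass center w := by
      have := mul_le_mul_of_nonneg_right h2 h3.le
      linarith
    have h5 := mul_le_mul_of_nonneg_left h4 hc.le
    rw [mass_center] at h5
    rw [mass_eq r]
    have := mul_le_mul_of_nonneg_right (min_le_left r.1 r.2) b1
    have := mul_le_mul_of_nonneg_right (min_le_right r.1 r.2) b2
    linarith
  have g1 := Real.log_le_log m1 up
  have g2 := Real.log_le_log (by positivity) low
  rw [Real.log_mul two_ne_zero m2.ne'] at g1
  rw [Real.log_mul hc.ne' m2.ne'] at g2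
  have := Real.log_nonneg (one_le_two (α := ℝ))
  have := neg_abs_le (Real.log c)
  have := abs_nonneg (Real.log c)
  rw [abs_le]; constructor <;> linarith

lemma IsSelfSimilar.hasLocalDim_iff_symmetrize (hμ : IsSelfSimilar P.p₀ P.p₁ P.p₂ μ) {x α : ℝ}
    (hx : x ∈ Ico (0 : ℝ) 1) : HasLocalDim μ x α ↔ HasLocalDim (symmetrize μ) x α := by
  rw [hμ.hasLocalDim_iff ⟨hx.1, hx.2.le⟩, hμ.hasLocalDim_symmetrize_iff ⟨hx.1, hx.2.le⟩]
  obtain ⟨C, hC⟩ := P.exists_abs_log_mass_sub_le hx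
  have h2 := Real.log_pos one_lt_two
  refine tendsto_iff_of_dist ?_
  refine squeeze_zero' (Eventually.of_forall fun _ => dist_nonneg) ?_
    (tendsto_const_div_atTop_nhds_zero_nat (C / Real.log 2))
  filter_upwards [hC, eventually_gt_atTop 0] with n hn h0
  have hn' : (0 : ℝ) < n := by exact_mod_cast h0
  rw [Real.dist_eq, ← sub_div, abs_div, abs_of_pos (show 0 < n * Real.log 2 by positivity),
    div_div, mul_comm (Real.log 2)]
  gcongr
  rw [abs_sub_comm] at hn
  rw [neg_sub_neg]
  exact hn

/-- The digit 1 keeps the row on the axis of (1,0) and multiplies it by p₁. -/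
lemma IsSelfSimilar.hasLocalDim_one_iff (hμ : IsSelfSimilar P.p₀ P.p₁ P.p₂ μ) {α : ℝ} :
    HasLocalDim μ 1 α ↔ α = -Real.logb 2 P.p₁ := by
  have hm : ∀ (n : ℕ) (a : ℝ), P.mass (a, 0) (List.replicate n true) = P.p₁ ^ n * a := by
    intro n
    induction n with
    | zero => intro a; simp [Weights.mass_nil, tot]
    | succ n ih =>
      intro a
      have : P.step (a, 0) true = (P.p₁ * a, 0) := by simp [Weights.step]
      rw [List.replicate_succ, Weights.mass_cons, this, ih]; ring
  have h2 := Real.log_pos one_lt_two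
  have ht : Tendsto (fun n : ℕ => -Real.log (P.mass (1, 0) (word 1 n)) / (n * Real.log 2))
      atTop (𝓝 (-Real.logb 2 P.p₁)) := by
    refine tendsto_const_nhds.congr' ?_
    filter_upwards [eventually_gt_atTop 0] with n h0
    have hn' : (0 : ℝ) < n := by exact_mod_cast h0
    rw [word_one, hm, mul_one, Real.log_pow, Real.logb]
    field_simp
  rw [hμ.hasLocalDim_iff (by simp)]
  exact ⟨fun h => tendsto_nhds_unique h ht, fun h => h ▸ ht⟩

end Measures

/-! ### Counting words of a given mass, and the upper bound for the dimension. -/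

lemma idx_word_mem_Icc {x : ℝ} (hx : x ∈ Icc (0 : ℝ) 1) (n : ℕ) :
    x ∈ Icc ((idx (word x n) : ℝ) / 2 ^ n) ((idx (word x n) + 1) / 2 ^ n) := by
  have h : (idx (word x n) : ℝ) ≤ 2 ^ n * x ∧ 2 ^ n * x ≤ idx (word x n) + 1 := by
    rcases hx.2.eq_or_lt with rfl | h
    · rw [word_one, idx_replicate_true, Nat.cast_sub Nat.one_le_two_pow]
      push_cast
      constructor <;> linarith
    · have := idx_word_mem ⟨hx.1, h⟩ n
      exact ⟨this.1, this.2.le⟩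
  have hN : (0 : ℝ) < 2 ^ n := by positivity
  rw [mem_Icc, div_le_iff₀ hN, le_div_iff₀ hN]
  constructor <;> linarith [h.1, h.2]

namespace Weights

variable (P : Weights)

/-- The words of length `n` whose mass is `2 ^ (-α n)` up to a factor `2 ^ (± ε n)`. -/
def goodWords (α ε : ℝ) (n : ℕ) : Finset (List Bool) :=
  open Classical in (words n).filter fun w =>
    |Real.log (P.mass center w) + α * (n * Real.log 2)| ≤ ε * (n * Real.log 2)

variable {P}

lemma mem_goodWords {α ε : ℝ} {n : ℕ} {w : List Bool} :
    w ∈ P.goodWords α ε n ↔ w.length = n ∧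
      |Real.log (P.mass center w) + α * (n * Real.log 2)| ≤ ε * (n * Real.log 2) := by
  unfold goodWords
  rw [Finset.mem_filter, mem_words]

lemma card_goodWords_mul_le (α ε q : ℝ) (n : ℕ) :
    (P.goodWords α ε n).card * Real.exp (-(α * q + |q| * ε) * (n * Real.log 2))
      ≤ P.moment 0 n q center := by
  have hp : ∀ w ∈ words n, 0 ≤ P.mass center w ^ q := fun w _ => by
    have := mass_pos (P := P) center_mem w
    positivity
  calc (P.goodWords α ε n).card * Real.exp (-(α * q + |q| * ε) * (n * Real.log 2))
      = ∑ w ∈ P.goodWords α ε n, Real.exp (-(α * q + |q| * ε) * (n * Real.log 2)) := by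
        rw [Finset.sum_const, nsmul_eq_mul]
    _ ≤ ∑ w ∈ P.goodWords α ε n, P.mass center w ^ q := by
        refine Finset.sum_le_sum fun w hw => ?_
        rw [Real.rpow_def_of_pos (mass_pos center_mem w)]
        apply Real.exp_le_exp.2
        have h := (mem_goodWords.1 hw).2
        have h1 := mul_le_mul_of_nonneg_left h (abs_nonneg q)
        rw [← abs_mul] at h1
        have h2 := neg_abs_le (q * (Real.log (P.mass center w) + α * (n * Real.log 2)))
        linarith
    _ ≤ ∑ w ∈ words n, P.mass center w ^ q :=
        Finset.sum_le_sum_of_subset_of_nonneg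
          (fun w hw => mem_words.2 (mem_goodWords.1 hw).1) fun w hw _ => hp w hw
    _ = _ := by simp [moment]

lemma moment_le_exp (q : ℝ) (n : ℕ) :
    P.moment 0 n q center ≤ Real.exp (P.tau q * (n * Real.log 2) + |q| * P.quasi) := by
  have h := (abs_le.1 (abs_log_moment_sub_le (P := P) q n)).2
  rw [← Real.exp_log (moment_zero_pos (P := P) center_mem n q)]
  exact Real.exp_le_exp.2 (by linarith)

lemma exp_le_moment (q : ℝ) (n : ℕ) :
    Real.exp (P.tau q * (n * Real.log 2) - |q| * P.quasi) ≤ P.moment 0 n q center := by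
  have h := (abs_le.1 (abs_log_moment_sub_le (P := P) q n)).1
  rw [← Real.exp_log (moment_zero_pos (P := P) center_mem n q)]
  exact Real.exp_le_exp.2 (by linarith)

variable (P) in
/-- The level sets of the local dimension of the symmetrized measure in terms of words. -/
def wordLevelSet (α : ℝ) : Set ℝ :=
  {x | x ∈ Icc (0 : ℝ) 1 ∧
    Tendsto (fun n : ℕ => -Real.log (P.mass center (word x n)) / (n * Real.log 2)) atTop (𝓝 α)}

/-- The moment sum is at least its single term at the word of `x`. -/
lemma nonneg_of_mem_wordLevelSet {x α : ℝ} (hx : x ∈ P.wordLevelSet α) (q : ℝ) :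
    0 ≤ α * q + P.tau q := by
  have h2 := Real.log_pos one_lt_two
  have t := (hx.2.mul_const q).add (tendsto_log_moment_div_mul (P := P) q)
  refine ge_of_tendsto' t fun n => ?_
  have hp := mass_pos (P := P) center_mem (word x n)
  have h : P.mass center (word x n) ^ q ≤ P.moment 0 n q center := by
    simp only [moment, pow_zero, mul_one]
    refine Finset.single_le_sum (f := fun w => P.mass center w ^ q) (fun w _ => ?_)
      (word_mem_words x n)
    have := mass_pos (P := P) center_mem w
    positivity
  have g := Real.log_le_log (by positivity) h
  rw [Real.log_rpow hp] at g
  rw [div_mul_eq_mul_div, ← add_div]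
  exact div_nonneg (by linarith) (by positivity)

/-- At each scale n ≥ N the good words cover `E`. Their number is bounded by Chebyshev's inequality
for the moment of order q, and the bounded error in the asymptotics of the moments keeps the sums
bounded. -/
lemma hausdorffMeasure_ne_top {α q ε s : ℝ} (hs0 : 0 ≤ s) (hs : α * q + P.tau q + |q| * ε ≤ s)
    {E : Set ℝ} (hE : E ⊆ Icc 0 1) {N : ℕ}
    (h : ∀ x ∈ E, ∀ n, N ≤ n → word x n ∈ P.goodWords α ε n) :
    μH[s] E ≠ ∞ := by
  have h2 := Real.log_pos one_lt_two
  have hdiam : ∀ n k : ℕ, Metric.ediam (Icc ((k : ℝ) / 2 ^ n) ((k + 1) / 2 ^ n))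
      = ENNReal.ofReal ((1 / 2) ^ n) := by
    intro n k
    rw [Real.ediam_Icc, ← sub_div, add_sub_cancel_left, one_div_pow]
  have key := Measure.hausdorffMeasure_le_liminf_sum (X := ℝ)
    (ι := fun n => {w // w ∈ P.goodWords α ε n}) s E (l := atTop)
    (fun n => ENNReal.ofReal ((1 / 2) ^ n))
    (by
      have := tendsto_pow_atTop_nhds_zero_of_lt_one (r := (1 / 2 : ℝ)) (by norm_num) (by norm_num)
      simpa using ENNReal.tendsto_ofReal this)
    -- Closed intervals are used so that the point 1 is covered too.
    (fun n w => Icc ((idx w.1 : ℝ) / 2 ^ n) ((idx w.1 + 1) / 2 ^ n))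
    (Eventually.of_forall fun n w => (hdiam n _).le)
    (by
      filter_upwards [eventually_ge_atTop N] with n hn x hx
      exact mem_iUnion.2 ⟨⟨word x n, h x hx n hn⟩, idx_word_mem_Icc (hE hx) n⟩)
  refine ne_top_of_le_ne_top (ENNReal.ofReal_ne_top (r := Real.exp (|q| * P.quasi)))
    (key.trans ?_)
  refine (liminf_le_liminf (v := fun _ => ENNReal.ofReal (Real.exp (|q| * P.quasi)))
    (Eventually.of_forall fun n => ?_)).trans_eq (liminf_const _)
  simp only [hdiam]
  rw [Finset.sum_const, Finset.card_univ, Fintype.card_coe, nsmul_eq_mul,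
    ENNReal.ofReal_rpow_of_nonneg (by positivity) hs0, ← ENNReal.ofReal_natCast,
    ← ENNReal.ofReal_mul (by positivity)]
  apply ENNReal.ofReal_le_ofReal
  have e : ((1 / 2 : ℝ) ^ n) ^ s = Real.exp (-s * (n * Real.log 2)) := by
    rw [Real.rpow_def_of_pos (by positivity), Real.log_pow, one_div, Real.log_inv]
    congr 1; ring
  rw [e]
  have h1 := (card_goodWords_mul_le (P := P) α ε q n).trans (moment_le_exp q n)
  have h3 := mul_le_mul_of_nonneg_right h1
    (Real.exp_pos ((α * q + |q| * ε - s) * (n * Real.log 2))).le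
  rw [mul_assoc, ← Real.exp_add, ← Real.exp_add] at h3
  have e2 : -(α * q + |q| * ε) * (n * Real.log 2) + (α * q + |q| * ε - s) * (n * Real.log 2)
      = -s * (n * Real.log 2) := by ring
  rw [e2] at h3
  refine h3.trans (Real.exp_le_exp.2 ?_)
  have h4 : (α * q + P.tau q + |q| * ε - s) * (n * Real.log 2) ≤ 0 :=
    mul_nonpos_of_nonpos_of_nonneg (by linarith) (by positivity)
  linarith

lemma dimH_wordLevelSet_le (α q : ℝ) :
    dimH (P.wordLevelSet α) ≤ ENNReal.ofReal (α * q + P.tau q) := by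
  rcases (P.wordLevelSet α).eq_empty_or_nonempty with h | ⟨x₀, hx₀⟩
  · rw [h]; simp
  have hD := nonneg_of_mem_wordLevelSet hx₀ q
  have h2 := Real.log_pos one_lt_two
  refine ENNReal.le_of_forall_pos_le_add fun ε hε _ => ?_
  have hε' : (0 : ℝ) < ε := hε
  set η : ℝ := ε / (|q| + 1) with hη
  have hη0 : 0 < η := by positivity
  have hqη : |q| * η ≤ ε := by
    rw [hη, mul_div_assoc', div_le_iff₀ (by positivity)]
    nlinarith [abs_nonneg q]
  -- Convergence is made uniform on countably many pieces; countable stability of the dimension then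
  -- applies.
  set E : ℕ → Set ℝ := fun N => {x | x ∈ P.wordLevelSet α ∧
    ∀ n, N ≤ n → word x n ∈ P.goodWords α η n} with hE
  have hcover : P.wordLevelSet α ⊆ ⋃ N, E N := by
    intro x hx
    obtain ⟨N, hN⟩ := Metric.tendsto_atTop.1 hx.2 η hη0
    refine mem_iUnion.2 ⟨N, hx, fun n hn => mem_goodWords.2 ⟨length_word x n, ?_⟩⟩
    have h := (hN n hn).le
    rcases Nat.eq_zero_or_pos n with rfl | hn0
    · simp [word, mass_nil, tot_center]
    have hn' : (0 : ℝ) < n := by exact_mod_cast hn0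
    have hp : 0 < n * Real.log 2 := by positivity
    rw [Real.dist_eq] at h
    have := mul_le_mul_of_nonneg_right h hp.le
    rw [← abs_of_pos hp, ← abs_mul, sub_mul, abs_of_pos hp, div_mul_cancel₀ _ hp.ne'] at this
    have e : Real.log (P.mass center (word x n)) + α * (n * Real.log 2)
        = -(-Real.log (P.mass center (word x n)) - α * (n * Real.log 2)) := by ring
    rwa [e, abs_neg]
  refine (dimH_mono hcover).trans ?_
  rw [dimH_iUnion]
  refine iSup_le fun N => ?_
  have hs0 : 0 ≤ α * q + P.tau q + ε := by positivity
  have := hausdorffMeasure_ne_top (P := P) (α := α) (q := q) (ε := η) hs0 (by linarith)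
    (E := E N) (fun x hx => hx.1.1) (fun x hx => hx.2)
  rw [← Real.coe_toNNReal _ hs0] at this
  refine (dimH_le_of_hausdorffMeasure_ne_top this).trans_eq ?_
  rw [← ENNReal.ofReal_coe_nnreal (p := ε), ← ENNReal.ofReal_add hD hε'.le]
  rfl

/-- Chernoff's bound: a word that is not good has too large or too small a mass, and its q-th power
is then dominated by the moment of order q + h or q - h with an exponential factor. -/
lemma moment_le_card_goodWords_add (q d ε : ℝ) {h : ℝ} (hh : 0 ≤ h) (n : ℕ) :
    P.moment 0 n q center ≤
      (P.goodWords (-d) ε n).card * Real.exp ((q * d + |q| * ε) * (n * Real.log 2))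
      + P.moment 0 n (q + h) center * Real.exp (-(h * (d + ε)) * (n * Real.log 2))
      + P.moment 0 n (q - h) center * Real.exp (h * (d - ε) * (n * Real.log 2)) := by
  classical
  set L := n * Real.log 2
  have e1 : (P.goodWords (-d) ε n).card * Real.exp ((q * d + |q| * ε) * L)
      = ∑ w ∈ words n, if w ∈ P.goodWords (-d) ε n then Real.exp ((q * d + |q| * ε) * L)
        else 0 := by
    rw [← Finset.sum_filter, Finset.sum_const, nsmul_eq_mul]
    congr 3
    ext w
    simp only [Finset.mem_filter, mem_words, mem_goodWords]
    tauto
  rw [e1]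
  simp only [moment, pow_zero, mul_one]
  rw [Finset.sum_mul, Finset.sum_mul, ← Finset.sum_add_distrib, ← Finset.sum_add_distrib]
  refine Finset.sum_le_sum fun w hw => ?_
  have hp := mass_pos (P := P) center_mem w
  rw [Real.rpow_def_of_pos hp, Real.rpow_def_of_pos hp, Real.rpow_def_of_pos hp,
    ← Real.exp_add, ← Real.exp_add]
  set X := Real.log (P.mass center w)
  by_cases hg : w ∈ P.goodWords (-d) ε n
  · rw [if_pos hg]
    have h1 := mul_le_mul_of_nonneg_left (mem_goodWords.1 hg).2 (abs_nonneg q)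
    rw [← abs_mul] at h1
    have h2 := le_abs_self (q * (X + -d * L))
    have h3 : X * q ≤ (q * d + |q| * ε) * L := by
      have : q * (X + -d * L) = X * q - q * d * L := by ring
      have : |q * (X + -d * L)| ≤ |q| * (ε * L) := h1
      linarith
    have h4 := Real.exp_le_exp.2 h3
    have h5 := Real.exp_pos (X * (q + h) + -(h * (d + ε)) * L)
    have h6 := Real.exp_pos (X * (q - h) + h * (d - ε) * L)
    linarith
  · rw [if_neg hg, zero_add]
    have h5 := Real.exp_pos (X * (q + h) + -(h * (d + ε)) * L)
    have h6 := Real.exp_pos (X * (q - h) + h * (d - ε) * L)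
    have hbad : ε * L < |X + -d * L| := by
      by_contra! hc
      exact hg (mem_goodWords.2 ⟨mem_words.1 hw, hc⟩)
    rcases lt_abs.1 hbad with hb | hb
    · have : X * q ≤ X * (q + h) + -(h * (d + ε)) * L := by
        have := mul_le_mul_of_nonneg_left hb.le hh
        linarith
      have := Real.exp_le_exp.2 this
      linarith
    · have : X * q ≤ X * (q - h) + h * (d - ε) * L := by
        have := mul_le_mul_of_nonneg_left hb.le hh
        linarith
      have := Real.exp_le_exp.2 this
      linarith

lemma eventually_card_goodWords_deriv (q : ℝ) {ε : ℝ} (hε : 0 < ε) :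
    ∀ᶠ n : ℕ in atTop,
      Real.exp ((P.tau q - q * deriv P.tau q - (|q| + 1) * ε) * (n * Real.log 2))
        ≤ (P.goodWords (-deriv P.tau q) ε n).card := by
  have h2 := Real.log_pos one_lt_two
  set d := deriv P.tau q with hd
  -- Differentiability of τ at q: the loss h·ε/2 against the tangent is half of the Chernoff gain
  -- h·ε, so both tails are exponentially negligible.
  obtain ⟨h, hh, hp, hm⟩ : ∃ h : ℝ, 0 < h ∧ P.tau (q + h) ≤ P.tau q + h * d + h * ε / 2 ∧
      P.tau (q - h) ≤ P.tau q - h * d + h * ε / 2 := by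
    have := (hasDerivAt_iff_isLittleO_nhds_zero.1 (P.hasDerivAt_tau q)).def (half_pos hε)
    obtain ⟨δ, hδ, H⟩ := Metric.eventually_nhds_iff.1 this
    refine ⟨δ / 2, half_pos hδ, ?_, ?_⟩
    · have := H (y := δ / 2) (by rw [Real.dist_eq, sub_zero, abs_of_pos] <;> linarith)
      rw [Real.norm_eq_abs, Real.norm_eq_abs, abs_of_pos (half_pos hδ), smul_eq_mul] at this
      linarith [(abs_le.1 this).2]
    · have := H (y := -(δ / 2)) (by
        rw [Real.dist_eq, sub_zero, abs_neg, abs_of_pos] <;> linarith)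
      rw [Real.norm_eq_abs, Real.norm_eq_abs, abs_neg, abs_of_pos (half_pos hδ), smul_eq_mul]
        at this
      have := (abs_le.1 this).2
      rw [← sub_eq_add_neg] at this
      linarith
  set C := max |q + h| |q - h| * P.quasi with hC
  have hQ := P.quasi_nonneg
  have tL : Tendsto (fun n : ℕ => n * Real.log 2) atTop atTop :=
    tendsto_natCast_atTop_atTop.atTop_mul_const h2
  have t1 : Tendsto (fun n : ℕ => Real.exp (C + -(h * ε / 2) * (n * Real.log 2))) atTop (𝓝 0) := by
    refine Real.tendsto_exp_atBot.comp (tendsto_atBot_add_const_left _ _ ?_)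
    exact tL.const_mul_atTop_of_neg (by have := mul_pos hh hε; linarith)
  have t2 : Tendsto (fun n : ℕ => Real.exp (-ε * (n * Real.log 2))) atTop (𝓝 0) :=
    Real.tendsto_exp_atBot.comp (tL.const_mul_atTop_of_neg (by linarith))
  have hB := Real.exp_pos (-(|q| * P.quasi))
  filter_upwards [t1.eventually_lt_const (show (0 : ℝ) < Real.exp (-(|q| * P.quasi)) / 4 by positivity),
    t2.eventually_lt_const (show (0 : ℝ) < Real.exp (-(|q| * P.quasi)) / 2 by positivity)]
    with n g1 g2
  have key := moment_le_card_goodWords_add (P := P) q d ε hh.le n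
  have k0 := exp_le_moment (P := P) q n
  have k1 := moment_le_exp (P := P) (q + h) n
  have k2 := moment_le_exp (P := P) (q - h) n
  set L := n * Real.log 2 with hL
  have hL0 : 0 ≤ L := by positivity
  have c1 : |q + h| * P.quasi ≤ C := mul_le_mul_of_nonneg_right (le_max_left _ _) hQ
  have c2 : |q - h| * P.quasi ≤ C := mul_le_mul_of_nonneg_right (le_max_right _ _) hQ
  have b1 : P.moment 0 n (q + h) center * Real.exp (-(h * (d + ε)) * L)
      ≤ Real.exp (P.tau q * L) * Real.exp (C + -(h * ε / 2) * L) := by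
    refine (mul_le_mul_of_nonneg_right k1 (Real.exp_pos _).le).trans ?_
    rw [← Real.exp_add, ← Real.exp_add]
    apply Real.exp_le_exp.2
    have := mul_le_mul_of_nonneg_right hp hL0
    linarith
  have b2 : P.moment 0 n (q - h) center * Real.exp (h * (d - ε) * L)
      ≤ Real.exp (P.tau q * L) * Real.exp (C + -(h * ε / 2) * L) := by
    refine (mul_le_mul_of_nonneg_right k2 (Real.exp_pos _).le).trans ?_
    rw [← Real.exp_add, ← Real.exp_add]
    apply Real.exp_le_exp.2
    have := mul_le_mul_of_nonneg_right hm hL0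
    linarith
  rw [sub_eq_add_neg, Real.exp_add] at k0
  have hT := Real.exp_pos (P.tau q * L)
  have b3 := mul_lt_mul_of_pos_left g1 hT
  have b4 := mul_lt_mul_of_pos_left g2 hT
  have b5 : Real.exp (P.tau q * L) * Real.exp (-ε * L)
      ≤ (P.goodWords (-d) ε n).card * Real.exp ((q * d + |q| * ε) * L) := by linarith
  have b6 := mul_le_mul_of_nonneg_right b5 (Real.exp_pos (-(q * d + |q| * ε) * L)).le
  rw [mul_assoc (Nat.cast _), ← Real.exp_add, ← Real.exp_add, ← Real.exp_add] at b6
  have e1 : (q * d + |q| * ε) * L + -(q * d + |q| * ε) * L = 0 := by ring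
  rw [e1, Real.exp_zero, mul_one] at b6
  refine le_trans (Real.exp_le_exp.2 (le_of_eq ?_)) b6
  ring

/-- Reduces a general α to a value -τ'(q). Only the endpoints may fail to be attained. There q → ±∞
approximates them, and the sign of q makes τ(q) - q·τ'(q) at least αq + τ(q). -/
lemma exists_deriv_tau_near {α s : ℝ} (hα : α ∈ Icc (-P.slopePos) (-P.slopeNeg))
    (hs : ∀ q, s ≤ α * q + P.tau q) {ε : ℝ} (hε : 0 < ε) :
    ∃ q, |α + deriv P.tau q| ≤ ε ∧ s ≤ P.tau q - q * deriv P.tau q := by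
  by_cases hatt : ∃ q, deriv P.tau q = -α
  · obtain ⟨q, hq⟩ := hatt
    refine ⟨q, by rw [hq]; simpa using hε.le, ?_⟩
    rw [hq]; linarith [hs q]
  have hpos : ∀ q, deriv P.tau q ≤ P.slopePos := deriv_tau_le_slopePos
  have hneg : ∀ q, P.slopeNeg ≤ deriv P.tau q := slopeNeg_le_deriv_tau
  rcases hα.1.eq_or_lt with h | h
  · obtain ⟨q, hq, hq0⟩ := ((tendsto_deriv_tau_atTop (P := P)).eventually_const_lt
      (show P.slopePos - ε < P.slopePos by linarith) |>.and (eventually_ge_atTop 0)).exists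
    refine ⟨q, ?_, ?_⟩
    · rw [abs_le]; constructor <;> linarith [hpos q]
    · have := hs q
      have := mul_le_mul_of_nonneg_right (hpos q) hq0
      rw [← h] at *
      linarith
  rcases hα.2.eq_or_lt with h' | h'
  · obtain ⟨q, hq, hq0⟩ := ((tendsto_deriv_tau_atBot (P := P)).eventually_lt_const
      (show P.slopeNeg < P.slopeNeg + ε by linarith) |>.and (eventually_le_atBot 0)).exists
    refine ⟨q, ?_, ?_⟩
    · rw [abs_le]; constructor <;> linarith [hneg q]
    · have := hs q
      have := mul_le_mul_of_nonpos_right (hneg q) hq0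
      rw [h'] at *
      linarith
  exfalso
  obtain ⟨q₁, h₁⟩ := ((tendsto_deriv_tau_atTop (P := P)).eventually_const_lt
    (show -α < P.slopePos by linarith)).exists
  obtain ⟨q₂, h₂⟩ := ((tendsto_deriv_tau_atBot (P := P)).eventually_lt_const
    (show P.slopeNeg < -α by linarith)).exists
  -- Darboux: a derivative takes intermediate values.
  have hoc := ordConnected_univ.image_deriv (f := P.tau) fun q _ => P.differentiable_tau q
  obtain ⟨q, -, hq⟩ := hoc.out (mem_image_of_mem _ (mem_univ q₂))
    (mem_image_of_mem _ (mem_univ q₁)) ⟨h₂.le, h₁.le⟩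
  exact hatt ⟨q, hq⟩

lemma goodWords_subset {α β ε η : ℝ} (h : η + |α - β| ≤ ε) (n : ℕ) :
    P.goodWords β η n ⊆ P.goodWords α ε n := by
  intro w hw
  obtain ⟨h1, h2⟩ := mem_goodWords.1 hw
  refine mem_goodWords.2 ⟨h1, ?_⟩
  have hL : 0 ≤ n * Real.log 2 := by
    have := Real.log_pos one_lt_two
    positivity
  set L := n * Real.log 2
  have e : Real.log (P.mass center w) + α * L
      = (Real.log (P.mass center w) + β * L) + (α - β) * L := by ring
  have h3 := mul_le_mul_of_nonneg_right h hL
  rw [e]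
  refine (abs_add_le _ _).trans ?_
  rw [abs_mul, abs_of_nonneg hL]
  linarith

/-- Lower bound for the number of words of a given mass. -/
lemma eventually_card_goodWords {α s : ℝ} (hα : α ∈ Icc (-P.slopePos) (-P.slopeNeg))
    (hs : ∀ q, s ≤ α * q + P.tau q) {ε : ℝ} (hε : 0 < ε) :
    ∀ᶠ n : ℕ in atTop,
      Real.exp ((s - ε) * (n * Real.log 2)) ≤ (P.goodWords α ε n).card := by
  have h2 := Real.log_pos one_lt_two
  obtain ⟨q, hq1, hq2⟩ := exists_deriv_tau_near hα hs (half_pos hε)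
  set η := ε / (2 * (|q| + 1)) with hη
  have hη0 : 0 < η := by positivity
  have e : (|q| + 1) * η = ε / 2 := by rw [hη]; field_simp
  have hηε : η ≤ ε / 2 := by nlinarith [abs_nonneg q]
  filter_upwards [eventually_card_goodWords_deriv (P := P) q hη0] with n hn
  have hsub : P.goodWords (-deriv P.tau q) η n ⊆ P.goodWords α ε n := by
    apply goodWords_subset
    rw [sub_neg_eq_add]
    linarith
  have hc : ((P.goodWords (-deriv P.tau q) η n).card : ℝ) ≤ (P.goodWords α ε n).card := by
    exact_mod_cast Finset.card_le_card hsub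
  refine (Real.exp_le_exp.2 ?_).trans (hn.trans hc)
  gcongr
  linarith

/-- Provides an admissible precision at every length, which the diagonal choice needs before the
asymptotic count sets in. -/
lemma goodWords_eq_words (α : ℝ) {ε : ℝ} (h : |α| * Real.log 2 - Real.log P.minRate
    ≤ ε * Real.log 2) (n : ℕ) : P.goodWords α ε n = words n := by
  ext w
  rw [mem_goodWords, mem_words]
  refine and_iff_left_of_imp fun hw => ?_
  have h2 := Real.log_pos one_lt_two
  have hm := log_mass_sub_mem (P := P) center_mem w
  rw [tot_center, Real.log_one, sub_zero, hw] at hm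
  have h3 := mul_le_mul_of_nonneg_left h (Nat.cast_nonneg (α := ℝ) n)
  refine (abs_add_le _ _).trans ?_
  rw [abs_of_nonpos hm.2, abs_mul, abs_of_nonneg (show 0 ≤ n * Real.log 2 by positivity)]
  linarith [hm.1]

end Weights

/-- Diagonal choice of a precision tending to zero. -/
lemma exists_tendsto_zero_of_eventually {Q : ℝ → ℕ → Prop}
    (hmono : ∀ a b n, a ≤ b → Q a n → Q b n) (hev : ∀ ε > 0, ∀ᶠ n in atTop, Q ε n)
    (hex : ∀ n, ∃ ε, 0 ≤ ε ∧ Q ε n) :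
    ∃ e : ℕ → ℝ, (∀ n, 0 ≤ e n) ∧ Tendsto e atTop (𝓝 0) ∧ ∀ n, Q (e n) n := by
  have hbdd : ∀ n, BddBelow {ε | 0 ≤ ε ∧ Q ε n} := fun n => ⟨0, fun ε h => h.1⟩
  have hnn : ∀ n, 0 ≤ sInf {ε | 0 ≤ ε ∧ Q ε n} := fun n => Real.sInf_nonneg fun ε h => h.1
  refine ⟨fun n => sInf {ε | 0 ≤ ε ∧ Q ε n} + 1 / ((n : ℝ) + 1), fun n => ?_, ?_, fun n => ?_⟩
  · have := hnn n
    positivity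
  · have t : Tendsto (fun n => sInf {ε | 0 ≤ ε ∧ Q ε n}) atTop (𝓝 0) := by
      rw [Metric.tendsto_atTop']
      intro ε hε
      obtain ⟨N, hN⟩ := eventually_atTop.1 (hev (ε / 2) (half_pos hε))
      refine ⟨N, fun n hn => ?_⟩
      rw [Real.dist_eq, sub_zero, abs_of_nonneg (hnn n)]
      have := csInf_le (hbdd n) (show ε / 2 ∈ {ε | 0 ≤ ε ∧ Q ε n} from
        ⟨(half_pos hε).le, hN n hn.le⟩)
      linarith
    simpa using t.add (tendsto_one_div_add_atTop_nhds_zero_nat (𝕜 := ℝ))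
  · have hlt : sInf {ε | 0 ≤ ε ∧ Q ε n}
        < sInf {ε | 0 ≤ ε ∧ Q ε n} + 1 / ((n : ℝ) + 1) := by
      have : (0 : ℝ) < 1 / ((n : ℝ) + 1) := by positivity
      linarith
    obtain ⟨a, ha, hlt'⟩ := exists_lt_of_csInf_lt (hex n) hlt
    exact hmono _ _ n hlt'.le ha.2

namespace Weights

variable {P : Weights}

lemma exists_card_goodWords_ge {α s : ℝ} (hα : α ∈ Icc (-P.slopePos) (-P.slopeNeg))
    (hs : ∀ q, s ≤ α * q + P.tau q) :
    ∃ e : ℕ → ℝ, (∀ n, 0 ≤ e n) ∧ Tendsto e atTop (𝓝 0) ∧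
      ∀ n : ℕ, Real.exp ((s - e n) * (n * Real.log 2)) ≤ (P.goodWords α (e n) n).card := by
  have h2 := Real.log_pos one_lt_two
  refine exists_tendsto_zero_of_eventually
    (Q := fun ε n => Real.exp ((s - ε) * (n * Real.log 2)) ≤ (P.goodWords α ε n).card) ?_
    (fun ε hε => eventually_card_goodWords hα hs hε) fun n => ?_
  · intro a b n hab h
    have hc : ((P.goodWords α a n).card : ℝ) ≤ (P.goodWords α b n).card := by
      exact_mod_cast Finset.card_le_card (goodWords_subset (by simpa using hab) n)
    refine le_trans (Real.exp_le_exp.2 ?_) (h.trans hc)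
    gcongr
  · have hc := P.log_minRate_nonpos
    set ε := |s| + |α| - Real.log P.minRate / Real.log 2 with hε
    have hdiv : 0 ≤ -(Real.log P.minRate / Real.log 2) := by
      rw [← neg_div]; exact div_nonneg (by linarith) h2.le
    have h3 := abs_nonneg s
    have h4 := abs_nonneg α
    refine ⟨ε, by linarith, ?_⟩
    rw [goodWords_eq_words, card_words]
    · have h5 : (s - ε) * (n * Real.log 2) ≤ 0 :=
        mul_nonpos_of_nonpos_of_nonneg (by linarith [le_abs_self s]) (by positivity)
      refine (Real.exp_le_one_iff.2 h5).trans ?_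
      exact_mod_cast Nat.one_le_two_pow
    · have e1 : ε * Real.log 2 = |s| * Real.log 2 + |α| * Real.log 2 - Real.log P.minRate := by
        rw [hε]; field_simp
      rw [e1]
      have := mul_nonneg h3 h2.le
      linarith

end Weights

/-! ### Points with prescribed local dimension, built from blocks of digits. -/

/-- The concatenation of the first `j` blocks. -/
def concat (β : ℕ → List Bool) : ℕ → List Bool
  | 0 => []
  | j + 1 => concat β j ++ β j

/-- The `j`-th triangular number, the length of the concatenation of `j` blocks of lengths
`1, …, j`. -/
def tri : ℕ → ℕ
  | 0 => 0
  | j + 1 => tri j + (j + 1)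

lemma two_mul_tri (j : ℕ) : 2 * (tri j : ℝ) = j * (j + 1) := by
  induction j with
  | zero => simp [tri]
  | succ j ih => rw [tri]; push_cast; linarith

lemma tri_mono : Monotone tri := monotone_nat_of_le_succ fun j => by rw [tri]; omega

lemma le_tri (j : ℕ) : j ≤ tri j := by
  induction j with
  | zero => simp [tri]
  | succ j ih => rw [tri]; omega

lemma exists_tri_le_lt (n : ℕ) : ∃ j, tri j ≤ n ∧ n < tri (j + 1) := by
  induction n with
  | zero => exact ⟨0, by simp [tri], by simp [tri]⟩
  | succ n ih =>
    obtain ⟨j, h1, h2⟩ := ih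
    by_cases h : n + 1 < tri (j + 1)
    · exact ⟨j, by omega, h⟩
    · refine ⟨j + 1, by omega, ?_⟩
      have : tri (j + 1 + 1) = tri (j + 1) + (j + 1 + 1) := rfl
      omega

/-- A sequence of blocks of lengths `1, 2, …`, each of which ends with the digit `0`. -/
def IsBlockSeq (β : ℕ → List Bool) : Prop := ∀ j, ∃ u : List Bool, u.length = j ∧ β j = u ++ [false]

/-- The point of `[0, 1)` whose binary expansion is the concatenation of the blocks. -/
def blockPoint (β : ℕ → List Bool) : ℝ := ⨆ j, (idx (concat β j) : ℝ) / 2 ^ tri j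

section Blocks

variable {β : ℕ → List Bool}

lemma IsBlockSeq.length_concat (h : IsBlockSeq β) (j : ℕ) : (concat β j).length = tri j := by
  induction j with
  | zero => rfl
  | succ j ih =>
    obtain ⟨u, hu, hβ⟩ := h j
    rw [concat, List.length_append, ih, hβ, List.length_append, hu]
    rfl

/-- The final digit 0 of the block leaves a free interval of length 2^(-`tri (j + 1)`) at the right
end. This gap excludes expansions ending in ones and separates points with different blocks. -/
lemma IsBlockSeq.left_le_left_succ (h : IsBlockSeq β) (j : ℕ) :
    (idx (concat β j) : ℝ) / 2 ^ tri j ≤ idx (concat β (j + 1)) / 2 ^ tri (j + 1) ∧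
      (idx (concat β (j + 1)) + 1 : ℝ) / 2 ^ tri (j + 1)
        ≤ (idx (concat β j) + 1) / 2 ^ tri j - 1 / 2 ^ tri (j + 1) := by
  obtain ⟨u, hu, hβ⟩ := h j
  have hlt := idx_lt u
  have hlt' : (idx u : ℝ) + 1 ≤ 2 ^ j := by rw [hu] at hlt; exact_mod_cast hlt
  have h0 : (0 : ℝ) ≤ idx u := Nat.cast_nonneg _
  have e : (idx (concat β (j + 1)) : ℝ) = idx (concat β j) * 2 ^ (j + 1) + 2 * idx u := by
    rw [concat, hβ, idx_append, idx_append]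
    simp only [List.length_append, hu, List.length_singleton, idx]
    push_cast
    simp
    ring
  have ht : (2 : ℝ) ^ tri (j + 1) = 2 ^ tri j * 2 ^ (j + 1) := by rw [tri, pow_add]
  have hN : (0 : ℝ) < 2 ^ tri j := by positivity
  have hM : (0 : ℝ) < 2 ^ (j + 1) := by positivity
  have hs : (2 : ℝ) ^ (j + 1) = 2 * 2 ^ j := by rw [pow_succ]; ring
  constructor
  · rw [e, ht, div_le_div_iff₀ hN (by positivity)]
    have := mul_nonneg hN.le h0
    nlinarith
  · rw [le_sub_iff_add_le, ← add_div, ht, div_le_div_iff₀ (by positivity) hN, e]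
    have : (idx (concat β j) : ℝ) * 2 ^ (j + 1) + 2 * idx u + 1 + 1
        ≤ (idx (concat β j) + 1) * 2 ^ (j + 1) := by rw [hs]; linarith
    calc _ ≤ ((idx (concat β j) : ℝ) + 1) * 2 ^ (j + 1) * 2 ^ tri j :=
          mul_le_mul_of_nonneg_right this hN.le
      _ = _ := by ring

lemma IsBlockSeq.blockPoint_mem (h : IsBlockSeq β) (j : ℕ) :
    (idx (concat β j) : ℝ) / 2 ^ tri j ≤ blockPoint β ∧
      blockPoint β ≤ (idx (concat β j) + 1) / 2 ^ tri j - 1 / 2 ^ tri (j + 1) := by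
  have hmono : Monotone fun j => (idx (concat β j) : ℝ) / 2 ^ tri j :=
    monotone_nat_of_le_succ fun j => (h.left_le_left_succ j).1
  have hanti : Antitone fun j => (idx (concat β j) + 1 : ℝ) / 2 ^ tri j := by
    refine antitone_nat_of_succ_le fun j => (h.left_le_left_succ j).2.trans ?_
    have : (0 : ℝ) ≤ 1 / 2 ^ tri (j + 1) := by positivity
    linarith
  have hup : ∀ j k, (idx (concat β k) : ℝ) / 2 ^ tri k
      ≤ (idx (concat β j) + 1) / 2 ^ tri j - 1 / 2 ^ tri (j + 1) := by
    intro j k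
    refine le_trans ?_ (h.left_le_left_succ j).2
    refine (hmono (le_max_left k (j + 1))).trans (le_trans ?_ (hanti (le_max_right k (j + 1))))
    dsimp only
    gcongr
    linarith
  exact ⟨le_ciSup ⟨_, by rintro _ ⟨k, rfl⟩; exact hup 0 k⟩ j, ciSup_le (hup j)⟩

lemma IsBlockSeq.blockPoint_mem_Ico (h : IsBlockSeq β) : blockPoint β ∈ Ico (0 : ℝ) 1 := by
  obtain ⟨h1, h2⟩ := h.blockPoint_mem 0
  norm_num [concat, idx, tri] at h1 h2
  exact ⟨h1, by linarith⟩

lemma IsBlockSeq.word_blockPoint (h : IsBlockSeq β) (j : ℕ) :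
    word (blockPoint β) (tri j) = concat β j := by
  refine idx_inj (by rw [length_word, h.length_concat]) ?_
  rw [idx_word_eq_iff h.blockPoint_mem_Ico]
  obtain ⟨h1, h2⟩ := h.blockPoint_mem j
  have hN : (0 : ℝ) < 2 ^ tri j := by positivity
  have h3 : (0 : ℝ) < 1 / 2 ^ tri (j + 1) := by positivity
  rw [div_le_iff₀ hN] at h1
  have h4 : blockPoint β < (idx (concat β j) + 1) / 2 ^ tri j := by linarith
  rw [lt_div_iff₀ hN] at h4
  constructor <;> linarith

/-- Points with different blocks are apart. -/
lemma IsBlockSeq.eq_of_abs_sub_lt {γ : ℕ → List Bool} (hβ : IsBlockSeq β) (hγ : IsBlockSeq γ)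
    {j : ℕ} (h : |blockPoint β - blockPoint γ| < 1 / 2 ^ tri (j + 1)) :
    ∀ i < j, β i = γ i := by
  have key : ∀ i < j, concat β i = concat γ i → concat β (i + 1) = concat γ (i + 1) := by
    intro i hi _
    have hle : (1 : ℝ) / 2 ^ tri (j + 1) ≤ 1 / 2 ^ tri (i + 1 + 1) :=
      one_div_le_one_div_of_le (by positivity)
        (pow_le_pow_right₀ one_le_two (tri_mono (by omega)))
    have h' := abs_lt.1 (h.trans_le hle)
    obtain ⟨b1, b2⟩ := hβ.blockPoint_mem (i + 1)
    obtain ⟨c1, c2⟩ := hγ.blockPoint_mem (i + 1)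
    have hN : (0 : ℝ) < 2 ^ tri (i + 1) := by positivity
    refine idx_inj (by rw [hβ.length_concat, hγ.length_concat]) ?_
    have d1 : (idx (concat β (i + 1)) : ℝ) / 2 ^ tri (i + 1)
        < (idx (concat γ (i + 1)) + 1) / 2 ^ tri (i + 1) := by linarith [h'.1, h'.2]
    have d2 : (idx (concat γ (i + 1)) : ℝ) / 2 ^ tri (i + 1)
        < (idx (concat β (i + 1)) + 1) / 2 ^ tri (i + 1) := by linarith [h'.1, h'.2]
    rw [div_lt_div_iff_of_pos_right hN] at d1 d2
    norm_cast at d1 d2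
    omega
  have hall : ∀ i, i ≤ j → concat β i = concat γ i := by
    intro i
    induction i with
    | zero => intro _; rfl
    | succ i ih => intro hi; exact key i (by omega) (ih (by omega))
  intro i hi
  have := hall (i + 1) hi
  rw [concat, concat, hall i hi.le] at this
  exact List.append_cancel_left this

end Blocks

/-- A weighted form of Cesàro's theorem. -/
lemma exists_sum_mul_le {κ : ℕ → ℝ} (h0 : ∀ i, 0 ≤ κ i) (hκ : Tendsto κ atTop (𝓝 0)) :
    ∃ m : ℕ → ℝ, Tendsto m atTop (𝓝 0) ∧
      ∀ j : ℕ, ∑ i ∈ Finset.range j, ((i : ℝ) + 1) * κ i ≤ (j : ℝ) ^ 2 * m j := by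
  refine ⟨_, hκ.cesaro, fun j => ?_⟩
  rcases Nat.eq_zero_or_pos j with rfl | hj
  · simp
  have hj' : (0 : ℝ) < j := by exact_mod_cast hj
  calc ∑ i ∈ Finset.range j, ((i : ℝ) + 1) * κ i ≤ ∑ i ∈ Finset.range j, (j : ℝ) * κ i := by
        refine Finset.sum_le_sum fun i hi => mul_le_mul_of_nonneg_right ?_ (h0 i)
        exact_mod_cast Finset.mem_range.1 hi
    _ = (j : ℝ) ^ 2 * ((j : ℝ)⁻¹ * ∑ i ∈ Finset.range j, κ i) := by
        rw [← Finset.mul_sum]; field_simp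

namespace Weights

variable {P : Weights}

lemma abs_log_mass_center_le (w : List Bool) :
    |Real.log (P.mass center w)| ≤ w.length * -Real.log P.minRate := by
  have h := log_mass_sub_mem (P := P) center_mem w
  rw [tot_center, Real.log_one, sub_zero] at h
  rw [abs_of_nonpos h.2]
  linarith [h.1]

/-- After j blocks the length is of order j². The block errors sum to o(j²) by Cesàro, and both the
j quasi-multiplicativity errors and the unfinished block are O(j). -/
lemma tendsto_log_mass_blockPoint {β : ℕ → List Bool} (hβ : IsBlockSeq β) {α : ℝ} {η : ℕ → ℝ}
    (hη0 : ∀ j, 0 ≤ η j) (hη : Tendsto η atTop (𝓝 0))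
    (h : ∀ j : ℕ, |Real.log (P.mass center (β j)) + α * ((j + 1) * Real.log 2)|
      ≤ (j + 1) * η j) :
    Tendsto (fun n : ℕ => -Real.log (P.mass center (word (blockPoint β) n)) / (n * Real.log 2))
      atTop (𝓝 α) := by
  have h2 := Real.log_pos one_lt_two
  set C := P.quasi with hC
  have hC0 : 0 ≤ C := quasi_nonneg
  set l := Real.log 2
  have hκ : Tendsto (fun i : ℕ => η i + C * (1 / ((i : ℝ) + 1))) atTop (𝓝 0) := by
    simpa using hη.add ((tendsto_one_div_add_atTop_nhds_zero_nat (𝕜 := ℝ)).const_mul C)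
  obtain ⟨m, hm, hsum⟩ := exists_sum_mul_le (fun i => by have := hη0 i; positivity) hκ
  have hpre : ∀ j : ℕ, |Real.log (P.mass center (concat β j)) + α * (tri j * l)|
      ≤ ∑ i ∈ Finset.range j, ((i : ℝ) + 1) * (η i + C * (1 / ((i : ℝ) + 1))) := by
    intro j
    induction j with
    | zero => simp [concat, tri, mass_nil, tot_center]
    | succ j ih =>
      rw [Finset.sum_range_succ, concat, tri]
      have a1 := abs_log_mass_append_le (P := P) (concat β j) (β j)
      have a2 := h j
      have e : ((j : ℝ) + 1) * (η j + C * (1 / ((j : ℝ) + 1))) = (j + 1) * η j + C := by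
        field_simp
      rw [e]
      push_cast
      rw [abs_le] at *
      constructor <;> linarith [ih.1, ih.2, a1.1, a1.2, a2.1, a2.2]
  set D := -Real.log P.minRate + |α| * l + C with hD
  have hD0 : 0 ≤ D := by
    have := P.log_minRate_nonpos
    have := mul_nonneg (abs_nonneg α) h2.le
    linarith
  have hmain : ∀ n j : ℕ, 1 ≤ j → tri j ≤ n → n < tri (j + 1) →
      |Real.log (P.mass center (word (blockPoint β) n)) + α * (n * l)|
        ≤ n * (2 * (m j + D / j)) := by
    intro n j hj h1 h3
    obtain ⟨k, rfl⟩ := Nat.exists_eq_add_of_le h1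
    have hk : k ≤ j := by rw [tri] at h3; omega
    have hk' : (k : ℝ) ≤ j := by exact_mod_cast hk
    have hj' : (1 : ℝ) ≤ j := by exact_mod_cast hj
    rw [word_add, hβ.word_blockPoint]
    set v := word (doubling^[tri j] (blockPoint β)) k with hv
    have a1 := abs_log_mass_append_le (P := P) (concat β j) v
    have a2 := abs_log_mass_center_le (P := P) v
    rw [hv, length_word, ← hv] at a2
    have a3 := (hpre j).trans (hsum j)
    have a4 : |α * (k * l)| ≤ |α| * (k * l) := by
      rw [abs_mul, abs_of_nonneg (show 0 ≤ (k : ℝ) * l by positivity)]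
    have a5 : (k : ℝ) * (-Real.log P.minRate + |α| * l)
        ≤ j * (-Real.log P.minRate + |α| * l) := by
      have : 0 ≤ -Real.log P.minRate + |α| * l := by
        have := P.log_minRate_nonpos
        have := mul_nonneg (abs_nonneg α) h2.le
        linarith
      gcongr
    have a6 : C ≤ j * C := le_mul_of_one_le_left hC0 hj'
    have a7 : |Real.log (P.mass center (concat β j ++ v)) + α * ((tri j + k : ℕ) * l)|
        ≤ (j : ℝ) ^ 2 * m j + j * D := by
      push_cast
      rw [hD]
      rw [abs_le] at *
      constructor <;> linarith [a1.1, a1.2, a2.1, a2.2, a3.1, a3.2, a4.1, a4.2]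
    have a8 : (j : ℝ) ^ 2 * m j + j * D = (j : ℝ) ^ 2 * (m j + D / j) := by field_simp
    have a9 : 0 ≤ m j + D / j := by
      have := (abs_nonneg _).trans a7
      rw [a8] at this
      exact nonneg_of_mul_nonneg_right this (by positivity)
    refine a7.trans ?_
    rw [a8]
    have a10 : (j : ℝ) ^ 2 ≤ (tri j + k : ℕ) * 2 := by
      have := two_mul_tri j
      push_cast
      nlinarith
    calc (j : ℝ) ^ 2 * (m j + D / j) ≤ ((tri j + k : ℕ) * 2) * (m j + D / j) := by gcongr
      _ = _ := by ring
  have ht : Tendsto (fun j : ℕ => 2 * (m j + D / j) / l) atTop (𝓝 0) := by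
    have := ((hm.add (tendsto_const_div_atTop_nhds_zero_nat D)).const_mul 2).div_const l
    simpa using this
  rw [Metric.tendsto_atTop]
  intro ε hε
  obtain ⟨J, hJ⟩ := eventually_atTop.1 (ht.eventually_lt_const hε)
  refine ⟨tri (J + 1), fun n hn => ?_⟩
  obtain ⟨j, h1, h3⟩ := exists_tri_le_lt n
  have hj : J + 1 ≤ j := by
    by_contra! hc
    have := tri_mono (show j + 1 ≤ J + 1 by omega)
    omega
  have hn0 : 0 < n := by
    have := le_tri j
    omega
  have hn' : (0 : ℝ) < n := by exact_mod_cast hn0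
  have hb := hmain n j (by omega) h1 h3
  have hL : (0 : ℝ) < n * l := by positivity
  refine lt_of_le_of_lt ?_ (hJ j (by omega))
  rw [Real.dist_eq]
  have e : -Real.log (P.mass center (word (blockPoint β) n)) / (n * l) - α
      = -(Real.log (P.mass center (word (blockPoint β) n)) + α * (n * l)) / (n * l) := by
    field_simp
    ring
  rw [e, abs_div, abs_neg, abs_of_pos hL, div_le_div_iff₀ hL h2]
  calc _ ≤ n * (2 * (m j + D / j)) * l := by gcongr
    _ = _ := by ring

end Weights

/-! ### A Hölder parametrization and the lower bound for the dimension. -/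

lemma exists_injOn_of_card_le {s t : Finset (List Bool)} (h : s.card ≤ t.card) :
    ∃ f : List Bool → List Bool, (∀ w ∈ s, f w ∈ t) ∧ ∀ w ∈ s, ∀ v ∈ s, f w = f v → w = v := by
  classical
  obtain ⟨f⟩ : Nonempty (s ↪ t) := Function.Embedding.nonempty_of_card_le (by simpa using h)
  refine ⟨fun w => if hw : w ∈ s then f ⟨w, hw⟩ else [], fun w hw => ?_, fun w hw v hv e => ?_⟩
  · beta_reduce; rw [dif_pos hw]; exact (f ⟨w, hw⟩).2
  · beta_reduce at e; rw [dif_pos hw, dif_pos hv] at e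
    simpa using f.injective (Subtype.ext e)

lemma abs_sub_le_of_word_eq {x y : ℝ} (hx : x ∈ Ico (0 : ℝ) 1) (hy : y ∈ Ico (0 : ℝ) 1) {n : ℕ}
    (h : word x n = word y n) : |x - y| ≤ 1 / 2 ^ n := by
  have h1 := idx_word_mem hx n
  have h2 := idx_word_mem hy n
  rw [← h] at h2
  have hN : (0 : ℝ) < 2 ^ n := by positivity
  rw [le_div_iff₀ hN, ← abs_of_pos hN, ← abs_mul, abs_le]
  constructor <;> linarith [h1.1, h1.2, h2.1, h2.2]

/-- Hölder bounds from bounds along the scales `2 ^ (-tri j)`. -/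
lemma le_mul_rpow_of_scales {Y D r K : ℝ} (hr : 0 < r) (hD : 0 ≤ D) (hY : Y ≤ 1) (hK : 0 ≤ K)
    (h : ∀ j : ℕ, D < 1 / 2 ^ tri (j + 1) → Y ≤ K * (1 / 2 ^ tri (j + 2)) ^ r) :
    Y ≤ (K + 2 ^ r) * D ^ r := by
  have h2r : (0 : ℝ) < 2 ^ r := by positivity
  have hscale : ∀ j : ℕ, (1 : ℝ) / 2 ^ tri j ≤ (1 / 2) ^ j := by
    intro j
    rw [one_div_pow]
    exact one_div_le_one_div_of_le (by positivity) (pow_le_pow_right₀ one_le_two (le_tri j))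
  have hgeom : Tendsto (fun n : ℕ => (1 / 2 : ℝ) ^ n) atTop (𝓝 0) :=
    tendsto_pow_atTop_nhds_zero_of_lt_one (by norm_num) (by norm_num)
  rcases hD.eq_or_lt with rfl | hD0
  · rw [Real.zero_rpow hr.ne', mul_zero]
    have t1 : Tendsto (fun j : ℕ => (1 : ℝ) / 2 ^ tri (j + 2)) atTop (𝓝 0) :=
      squeeze_zero (fun j => by positivity) (fun j => hscale (j + 2))
        (hgeom.comp (tendsto_add_atTop_nat 2))
    have t2 := ((t1.rpow_const (Or.inr hr.le)).const_mul K)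
    rw [Real.zero_rpow hr.ne', mul_zero] at t2
    exact ge_of_tendsto' t2 fun j => h j (by positivity)
  by_cases hlarge : 1 / 2 ≤ D
  · have h1 : (1 / 2 : ℝ) ^ r ≤ D ^ r := by gcongr
    have h3 : (2 : ℝ) ^ r * (1 / 2) ^ r = 1 := by
      rw [← Real.mul_rpow (by norm_num) (by norm_num)]; norm_num
    have h4 := mul_le_mul_of_nonneg_left h1 h2r.le
    have h5 : 0 ≤ K * D ^ r := by positivity
    linarith
  -- The first such k is positive since D < 1/2. With k = j + 1, D lies between the scales `tri (j +
  -- 2)` and `tri (j + 1)`, which is why the hypothesis pairs these two.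
  · have hex : ∃ k : ℕ, (1 : ℝ) / 2 ^ tri (k + 1) ≤ D := by
      obtain ⟨n, hn⟩ := (hgeom.eventually_lt_const hD0).exists
      refine ⟨n, (hscale (n + 1)).trans (le_trans ?_ hn.le)⟩
      exact pow_le_pow_of_le_one (by norm_num) (by norm_num) (Nat.le_succ n)
    classical
    have hk := Nat.find_spec hex
    have hmin : ∀ m, m < Nat.find hex → ¬ (1 : ℝ) / 2 ^ tri (m + 1) ≤ D := fun m hm =>
      Nat.find_min hex hm
    rcases hk0 : Nat.find hex with _ | j
    · rw [hk0] at hk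
      norm_num [tri] at hk hlarge
      linarith
    · rw [hk0] at hk
      have h1 := h j (not_le.1 (hmin j (by omega)))
      refine h1.trans ?_
      have h3 : ((1 : ℝ) / 2 ^ tri (j + 2)) ^ r ≤ D ^ r := by gcongr
      have h4 := mul_le_mul_of_nonneg_left h3 hK
      have h5 : 0 ≤ (2 : ℝ) ^ r * D ^ r := by positivity
      linarith

lemma sum_succ_eq_tri (j : ℕ) : ∑ i ∈ Finset.range j, ((i : ℝ) + 1) = tri j := by
  induction j with
  | zero => simp [tri]
  | succ j ih => rw [Finset.sum_range_succ, ih, tri]; push_cast; ring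

/-- Growth of the partial sums of block dimensions. -/
lemma exists_tri_sub_sum_le {s : ℝ} (hs : 0 < s) {e : ℕ → ℝ} (he0 : ∀ n, 0 ≤ e n)
    (he : Tendsto e atTop (𝓝 0)) {a : ℕ → ℕ} (ha : ∀ j : ℕ, j * (s - e j) - 1 ≤ a j) {r : ℝ}
    (hr0 : 0 < r) (hr : r < s) :
    ∃ K : ℝ, ∀ j : ℕ, r * tri (j + 2) - (∑ i ∈ Finset.range j, a i : ℕ) ≤ K := by
  -- Block i has length i + 1 but encodes about i·(s - e i) digits: the closing 0 costs s and the
  -- integer part costs 1.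
  have hκ : Tendsto (fun i : ℕ => e i + (s + 1) * (1 / ((i : ℝ) + 1))) atTop (𝓝 0) := by
    simpa using he.add ((tendsto_one_div_add_atTop_nhds_zero_nat (𝕜 := ℝ)).const_mul (s + 1))
  obtain ⟨m, hm, hsum⟩ := exists_sum_mul_le (fun i => by have := he0 i; positivity) hκ
  have h1 : ∀ j : ℕ, s * tri j - (∑ i ∈ Finset.range j, a i : ℕ) ≤ (j : ℝ) ^ 2 * m j := by
    intro j
    refine le_trans ?_ (hsum j)
    rw [← sum_succ_eq_tri, Finset.mul_sum, Nat.cast_sum, ← Finset.sum_sub_distrib]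
    refine Finset.sum_le_sum fun i _ => ?_
    have e1 : ((i : ℝ) + 1) * (e i + (s + 1) * (1 / ((i : ℝ) + 1))) = (i + 1) * e i + (s + 1) := by
      field_simp
    rw [e1]
    have := ha i
    have := he0 i
    linarith
  have hev : ∀ᶠ j : ℕ in atTop,
      r * tri (j + 2) - (∑ i ∈ Finset.range j, a i : ℕ) ≤ 0 := by
    have t : Tendsto (fun j : ℕ => m j + 5 * r / j) atTop (𝓝 0) := by
      simpa using hm.add (tendsto_const_div_atTop_nhds_zero_nat (5 * r))
    filter_upwards [t.eventually_lt_const (show 0 < (s - r) / 2 by linarith),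
      eventually_ge_atTop 1] with j hj h1j
    have hj' : (1 : ℝ) ≤ j := by exact_mod_cast h1j
    have e2 : (tri (j + 2) : ℝ) = tri j + (2 * j + 3) := by
      have : tri (j + 2) = tri j + (j + 1) + (j + 1 + 1) := rfl
      rw [this]; push_cast; ring
    have h2 := two_mul_tri j
    have h3 := h1 j
    have h4 := mul_le_mul_of_nonneg_left hj.le (sq_nonneg (j : ℝ))
    have e3 : (j : ℝ) ^ 2 * (m j + 5 * r / j) = (j : ℝ) ^ 2 * m j + 5 * r * j := by field_simp
    rw [e3] at h4
    rw [e2]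
    have h5 : (s - r) * (j : ℝ) ^ 2 ≤ (s - r) * (2 * tri j) :=
      mul_le_mul_of_nonneg_left (by nlinarith) (by linarith)
    have h6 : r * (2 * j + 3) ≤ 5 * r * j := by nlinarith
    linarith
  obtain ⟨K, hK⟩ := (isBoundedUnder_of_eventually_le hev).bddAbove_range
  exact ⟨K, fun j => hK ⟨j, rfl⟩⟩

namespace Weights

variable {P : Weights}

/-- A family of points of given local dimension, with a Hölder continuous parameter. -/
lemma exists_holder_family {α s : ℝ} (hα : α ∈ Icc (-P.slopePos) (-P.slopeNeg))
    (hs : ∀ q, s ≤ α * q + P.tau q) :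
    ∃ F : ℝ → ℝ, (∀ y, F y ∈ P.wordLevelSet α ∩ Ico 0 1) ∧
      ∀ r : ℝ, 0 < r → r < s → ∃ K : ℝ, 0 ≤ K ∧
        ∀ y ∈ Ico (0 : ℝ) 1, ∀ z ∈ Ico (0 : ℝ) 1, |y - z| ≤ K * |F y - F z| ^ r := by
  have h2 := Real.log_pos one_lt_two
  obtain ⟨e, he0, he, hcard⟩ := exists_card_goodWords_ge hα hs
  -- The number of parameter digits that good words of length j can encode injectively. The natural
  -- floor is 0 when the product is negative, and then one good word suffices.
  set a : ℕ → ℕ := fun j => ⌊(j : ℝ) * (s - e j)⌋₊ with ha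
  have hle : ∀ j, (words (a j)).card ≤ (P.goodWords α (e j) j).card := by
    intro j
    rw [card_words]
    have hc := hcard j
    rcases Nat.eq_zero_or_pos (a j) with h0 | h0
    · rw [h0, pow_zero]
      have : (0 : ℝ) < (P.goodWords α (e j) j).card := (Real.exp_pos _).trans_le hc
      exact_mod_cast this
    · have h1 : (a j : ℝ) ≤ j * (s - e j) := by
        refine Nat.floor_le ?_
        exact zero_le_one.trans (Nat.floor_pos.1 h0)
      have h3 : (2 : ℝ) ^ a j = Real.exp (a j * Real.log 2) := by
        rw [← Real.log_pow, Real.exp_log (by positivity)]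
      have h4 : (2 : ℝ) ^ a j ≤ (P.goodWords α (e j) j).card := by
        rw [h3]
        refine le_trans (Real.exp_le_exp.2 ?_) hc
        have := mul_le_mul_of_nonneg_right h1 h2.le
        linarith
      exact_mod_cast h4
  choose φ hφ hinj using fun j => exists_injOn_of_card_le (hle j)
  set A : ℕ → ℕ := fun j => ∑ i ∈ Finset.range j, a i with hA
  -- The digits of y are cut into groups of lengths `a j`, and each group is replaced by its good
  -- word and a closing 0.
  set β : ℝ → ℕ → List Bool := fun y j => φ j (word (doubling^[A j] y) (a j)) ++ [false] with hβ
  have hmem : ∀ y j, φ j (word (doubling^[A j] y) (a j)) ∈ P.goodWords α (e j) j := fun y j =>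
    hφ j _ (word_mem_words _ _)
  have hblock : ∀ y, IsBlockSeq (β y) := fun y j => ⟨_, (mem_goodWords.1 (hmem y j)).1, rfl⟩
  refine ⟨fun y => blockPoint (β y), fun y => ?_, fun r hr0 hrs => ?_⟩
  · have hI := (hblock y).blockPoint_mem_Ico
    refine ⟨⟨⟨hI.1, hI.2.le⟩, ?_⟩, hI⟩
    set C := P.quasi + |Real.log (P.mass center [false])| + |α| * Real.log 2 with hC
    have hC0 : 0 ≤ C := by
      have := P.quasi_nonneg
      positivity
    have hη : Tendsto (fun j : ℕ => e j * Real.log 2 + C * (1 / ((j : ℝ) + 1))) atTop (𝓝 0) := by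
      simpa using (he.mul_const (Real.log 2)).add
        ((tendsto_one_div_add_atTop_nhds_zero_nat (𝕜 := ℝ)).const_mul C)
    refine tendsto_log_mass_blockPoint (hblock y) (fun j => ?_) hη fun j => ?_
    · have := he0 j
      positivity
    · have b1 := (mem_goodWords.1 (hmem y j)).2
      have b2 := abs_log_mass_append_le (P := P) (φ j (word (doubling^[A j] y) (a j))) [false]
      have b3 : |α * Real.log 2| ≤ |α| * Real.log 2 := by rw [abs_mul, abs_of_pos h2]
      have b4 := abs_le.1 (le_refl |Real.log (P.mass center [false])|)
      have e1 : ((j : ℝ) + 1) * (e j * Real.log 2 + C * (1 / ((j : ℝ) + 1)))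
          = (j + 1) * (e j * Real.log 2) + C := by field_simp
      have b5 : 0 ≤ e j * Real.log 2 := by have := he0 j; positivity
      rw [e1, hC]
      change |Real.log (P.mass center (_ ++ _)) + _| ≤ _
      generalize |Real.log (P.mass center [false])| = c at b4 ⊢
      rw [abs_le] at *
      constructor <;> linarith [b1.1, b1.2, b2.1, b2.2, b3.1, b3.2, b4.1, b4.2]
  · obtain ⟨K, hK⟩ := exists_tri_sub_sum_le (hr0.trans hrs) he0 he (a := a)
      (fun j => by have := Nat.lt_floor_add_one ((j : ℝ) * (s - e j)); linarith) hr0 hrs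
    refine ⟨2 ^ K + 2 ^ r, by positivity, fun y hy z hz => ?_⟩
    refine le_mul_rpow_of_scales hr0 (abs_nonneg _) ?_ (by positivity) fun j hj => ?_
    · rw [abs_le]; constructor <;> linarith [hy.1, hy.2, hz.1, hz.2]
    · have heq := (hblock y).eq_of_abs_sub_lt (hblock z) hj
      -- Equal blocks decode to equal digits of the parameters.
      have hw : ∀ i, i ≤ j → word y (A i) = word z (A i) := by
        intro i
        induction i with
        | zero => intro _; rfl
        | succ i ih =>
          intro hi
          have e1 : A (i + 1) = A i + a i := Finset.sum_range_succ _ _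
          rw [e1, word_add, word_add, ih (by omega)]
          congr 1
          refine hinj i _ (word_mem_words _ _) _ (word_mem_words _ _) ?_
          exact List.append_cancel_right (heq i (by omega))
      refine (abs_sub_le_of_word_eq hy hz (hw j le_rfl)).trans ?_
      have e1 : ∀ n : ℕ, (1 : ℝ) / 2 ^ n = 2 ^ (-(n : ℝ)) := fun n => by
        rw [Real.rpow_neg two_pos.le, Real.rpow_natCast, one_div]
      rw [e1, e1, ← Real.rpow_mul two_pos.le, ← Real.rpow_add two_pos]
      refine Real.rpow_le_rpow_of_exponent_le one_le_two ?_
      have := hK j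
      linarith

/-- For α = -τ'(p) the construction gives a point of the level set with s = τ(p) - p·τ'(p), whatever
its sign, and a nonempty level set forces nonnegativity. Letting p → ±∞ reaches the endpoints, and
linearity in α the rest. -/
lemma nonneg_of_mem_Icc {α : ℝ} (hα : α ∈ Icc (-P.slopePos) (-P.slopeNeg)) (q : ℝ) :
    0 ≤ α * q + P.tau q := by
  have hatt : ∀ p, 0 ≤ -deriv P.tau p * q + P.tau q := by
    intro p
    obtain ⟨F, hF, -⟩ := exists_holder_family (P := P) (α := -deriv P.tau p)
      (s := P.tau p - p * deriv P.tau p)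
      ⟨neg_le_neg (deriv_tau_le_slopePos p), neg_le_neg (slopeNeg_le_deriv_tau p)⟩
      (fun r => by linarith [tau_ge_tangent (P := P) p r])
    exact nonneg_of_mem_wordLevelSet (hF 0).1 q
  rcases le_total 0 q with hq | hq
  · have t := ((tendsto_deriv_tau_atTop (P := P)).neg.mul_const q).add_const (P.tau q)
    have := ge_of_tendsto' t hatt
    have := mul_le_mul_of_nonneg_right hα.1 hq
    linarith
  · have t := ((tendsto_deriv_tau_atBot (P := P)).neg.mul_const q).add_const (P.tau q)
    have := ge_of_tendsto' t hatt
    have := mul_le_mul_of_nonpos_right hα.2 hq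
    linarith

lemma wordLevelSet_inter_nonempty {α : ℝ} (hα : α ∈ Icc (-P.slopePos) (-P.slopeNeg)) :
    (P.wordLevelSet α ∩ Ico 0 1).Nonempty := by
  obtain ⟨F, hF, -⟩ := exists_holder_family hα (nonneg_of_mem_Icc hα)
  exact ⟨F 0, hF 0⟩

/-- The inverse of the parametrization is r-Hölder from a subset of the level set onto [0,1), which
has dimension 1. -/
lemma le_dimH_wordLevelSet {α s r : ℝ} (hα : α ∈ Icc (-P.slopePos) (-P.slopeNeg))
    (hs : ∀ q, s ≤ α * q + P.tau q) (hr0 : 0 < r) (hrs : r < s) :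
    ENNReal.ofReal r ≤ dimH (P.wordLevelSet α ∩ Ico 0 1) := by
  obtain ⟨F, hF, hH⟩ := exists_holder_family hα hs
  obtain ⟨K, hK0, hK⟩ := hH r hr0 hrs
  have hinj : InjOn F (Ico 0 1) := by
    intro y hy z hz hyz
    have := hK y hy z hz
    rw [hyz, sub_self, abs_zero, Real.zero_rpow hr0.ne', mul_zero] at this
    exact sub_eq_zero.1 (abs_nonpos_iff.1 this)
  set G := Function.invFunOn F (Ico (0 : ℝ) 1)
  have hG : ∀ y ∈ Ico (0 : ℝ) 1, G (F y) = y := fun y hy => hinj.leftInvOn_invFunOn hy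
  have hhold : HolderOnWith K.toNNReal r.toNNReal G (F '' Ico 0 1) := by
    rintro _ ⟨y, hy, rfl⟩ _ ⟨z, hz, rfl⟩
    rw [hG y hy, hG z hz, edist_dist, edist_dist, Real.dist_eq, Real.dist_eq,
      Real.coe_toNNReal _ hr0.le, ENNReal.ofReal_rpow_of_nonneg (abs_nonneg _) hr0.le]
    change _ ≤ ENNReal.ofReal K * _
    rw [← ENNReal.ofReal_mul hK0]
    exact ENNReal.ofReal_le_ofReal (hK y hy z hz)
  have h := hhold.dimH_image_le (Real.toNNReal_pos.2 hr0)
  have himg : G '' (F '' Ico 0 1) = Ico 0 1 := by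
    rw [image_image]
    exact (image_congr hG).trans (image_id' _)
  have hone : dimH (Ico (0 : ℝ) 1) = 1 := by
    rw [Real.dimH_of_nonempty_interior (by rw [interior_Ico]; exact nonempty_Ioo.2 one_pos)]
    simp
  rw [himg, hone] at h
  have hr' : (r.toNNReal : ℝ≥0∞) ≠ 0 := by
    simpa using hr0
  rw [ENNReal.le_div_iff_mul_le (Or.inl hr') (Or.inl ENNReal.coe_ne_top), one_mul] at h
  refine h.trans (dimH_mono ?_)
  rintro _ ⟨y, -, rfl⟩
  exact hF y

end Weights

/-! ### Level sets of μ and ν, and the conclusion. -/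

variable {P : Weights} {μ : Measure ℝ}

lemma IsSelfSimilar.levelSet_symmetrize (hμ : IsSelfSimilar P.p₀ P.p₁ P.p₂ μ) (α : ℝ) :
    levelSet (symmetrize μ) α = P.wordLevelSet α := by
  ext x
  exact and_congr_right fun hx => hμ.hasLocalDim_symmetrize_iff hx

lemma IsSelfSimilar.mem_levelSet_iff (hμ : IsSelfSimilar P.p₀ P.p₁ P.p₂ μ) {x α : ℝ} :
    x ∈ levelSet μ α ↔ x ∈ P.wordLevelSet α ∩ Ico 0 1 ∨ (x = 1 ∧ α = -Real.logb 2 P.p₁) := by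
  rw [← hμ.levelSet_symmetrize]
  constructor
  · rintro ⟨hx, h⟩
    rcases hx.2.eq_or_lt with rfl | hlt
    · exact Or.inr ⟨rfl, hμ.hasLocalDim_one_iff.1 h⟩
    · exact Or.inl ⟨⟨hx, (hμ.hasLocalDim_iff_symmetrize ⟨hx.1, hlt⟩).1 h⟩, hx.1, hlt⟩
  · rintro (⟨⟨hx, h⟩, hI⟩ | ⟨rfl, h⟩)
    · exact ⟨hx, (hμ.hasLocalDim_iff_symmetrize hI).2 h⟩
    · exact ⟨by simp, hμ.hasLocalDim_one_iff.2 h⟩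

lemma Weights.mem_Icc_of_mem_wordLevelSet {x α : ℝ} (hx : x ∈ P.wordLevelSet α) :
    α ∈ Icc (-P.slopePos) (-P.slopeNeg) :=
  mem_Icc_of_forall_nonneg (nonneg_of_mem_wordLevelSet hx)

lemma IsSelfSimilar.localDims_symmetrize (hμ : IsSelfSimilar P.p₀ P.p₁ P.p₂ μ) :
    localDims (symmetrize μ) = Icc (-P.slopePos) (-P.slopeNeg) := by
  ext α
  rw [localDims, mem_ofPred_eq, hμ.levelSet_symmetrize]
  exact ⟨fun ⟨_, hx⟩ => Weights.mem_Icc_of_mem_wordLevelSet hx,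
    fun h => (Weights.wordLevelSet_inter_nonempty h).mono inter_subset_left⟩

lemma IsSelfSimilar.localDims_eq (hμ : IsSelfSimilar P.p₀ P.p₁ P.p₂ μ) :
    localDims μ = Icc (-P.slopePos) (-P.slopeNeg) ∪ {-Real.logb 2 P.p₁} := by
  ext α
  rw [localDims, mem_ofPred_eq]
  constructor
  · rintro ⟨x, hx⟩
    rcases hμ.mem_levelSet_iff.1 hx with h | ⟨-, h⟩
    · exact Or.inl (Weights.mem_Icc_of_mem_wordLevelSet h.1)
    · exact Or.inr h
  · rintro (h | h)
    · obtain ⟨x, hx⟩ := Weights.wordLevelSet_inter_nonempty h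
      exact ⟨x, hμ.mem_levelSet_iff.2 (Or.inl hx)⟩
    · exact ⟨1, hμ.mem_levelSet_iff.2 (Or.inr ⟨rfl, h⟩)⟩

/-- By the spectral gap the exceptional point 1 does not contribute. -/
lemma IsSelfSimilar.levelSet_eq_of_mem (hμ : IsSelfSimilar P.p₀ P.p₁ P.p₂ μ) {α : ℝ}
    (hα : α ∈ Icc (-P.slopePos) (-P.slopeNeg)) :
    levelSet μ α = P.wordLevelSet α ∩ Ico 0 1 := by
  ext x
  rw [hμ.mem_levelSet_iff, or_iff_left]
  rintro ⟨-, rfl⟩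
  exact absurd hα.2 (not_le.2 Weights.neg_slopeNeg_lt)

lemma IsSelfSimilar.levelSet_neg_logb (hμ : IsSelfSimilar P.p₀ P.p₁ P.p₂ μ) :
    levelSet μ (-Real.logb 2 P.p₁) = {1} := by
  ext x
  rw [hμ.mem_levelSet_iff, or_iff_right]
  · simp
  · rintro ⟨h, -⟩
    exact absurd (Weights.mem_Icc_of_mem_wordLevelSet h).2 (not_le.2 Weights.neg_slopeNeg_lt)

lemma IsSelfSimilar.dimH_levelSet (hμ : IsSelfSimilar P.p₀ P.p₁ P.p₂ μ) {α : ℝ}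
    (hα : α ∈ Icc (-P.slopePos) (-P.slopeNeg)) :
    ((dimH (levelSet μ α) : ℝ≥0∞) : EReal) = legendre P.tau α := by
  rw [hμ.levelSet_eq_of_mem hα]
  refine le_antisymm (le_iInf fun q => ?_) ?_
  · have h := (dimH_mono (s := P.wordLevelSet α ∩ Ico 0 1) inter_subset_left).trans
      (Weights.dimH_wordLevelSet_le (P := P) α q)
    have h' := EReal.coe_ennreal_le_coe_ennreal_iff.2 h
    rwa [EReal.coe_ennreal_ofReal, max_eq_left (Weights.nonneg_of_mem_Icc hα q)] at h'
  · refine EReal.ge_of_forall_gt_iff_ge.1 fun r hr => ?_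
    rcases le_or_gt r 0 with h0 | h0
    · exact le_trans (by exact_mod_cast h0) (EReal.coe_ennreal_nonneg _)
    · obtain ⟨s, hrs, hs⟩ := EReal.lt_iff_exists_real_btwn.1 hr
      have hs' : ∀ q, s ≤ α * q + P.tau q := fun q => by
        have := hs.le.trans (iInf_le _ q)
        exact_mod_cast this
      have h := Weights.le_dimH_wordLevelSet hα hs' h0 (by exact_mod_cast hrs)
      have h' := EReal.coe_ennreal_le_coe_ennreal_iff.2 h
      rwa [EReal.coe_ennreal_ofReal, max_eq_left h0.le] at h'

end DyadicMultifractal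

end

theorem theorem5 (p₀ p₁ p₂ : ℝ) (hp₀ : 0 < p₀) (hp₁ : 0 < p₁) (hp₂ : 0 < p₂)
    (hsum : p₀ + p₁ + p₂ = 1) (hlt : p₁ < p₀)
    (μ : Measure ℝ) (hμ : DyadicMultifractal.IsSelfSimilar p₀ p₁ p₂ μ) :
    ∃ τ : ℝ → ℝ,
      -- `τ` is the `L^q`-spectrum of the symmetrized measure `ν`
      (∀ q : ℝ, DyadicMultifractal.lqSpectrum (DyadicMultifractal.symmetrize μ) q
        = ((τ q : ℝ) : EReal)) ∧
      Differentiable ℝ τ ∧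
      -- `dPos` and `dNeg` are `τ'(+∞)` and `τ'(-∞)`
      ∃ dPos dNeg : ℝ,
        Tendsto (deriv τ) atTop (𝓝 dPos) ∧
        Tendsto (deriv τ) atBot (𝓝 dNeg) ∧
        DyadicMultifractal.localDims μ
          = DyadicMultifractal.localDims (DyadicMultifractal.symmetrize μ)
              ∪ {-Real.logb 2 p₁} ∧
        DyadicMultifractal.localDims μ
          = Set.Icc (-dPos) (-dNeg) ∪ {-Real.logb 2 p₁} ∧
        -- `- log₂ p₁` is an isolated point of the set of local dimensions
        -dNeg < -Real.logb 2 p₁ ∧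
        (∃ ε : ℝ, 0 < ε ∧
          DyadicMultifractal.localDims μ ∩ Metric.ball (-Real.logb 2 p₁) ε
            = {-Real.logb 2 p₁}) ∧
        (∀ α ∈ Set.Icc (-dPos) (-dNeg),
          ((dimH (DyadicMultifractal.levelSet μ α) : ℝ≥0∞) : EReal)
            = DyadicMultifractal.legendre τ α) ∧
        dimH (DyadicMultifractal.levelSet μ (-Real.logb 2 p₁)) = 0 := by

  obtain ⟨P, rfl, rfl, rfl⟩ : ∃ P : DyadicMultifractal.Weights,
      P.p₀ = p₀ ∧ P.p₁ = p₁ ∧ P.p₂ = p₂ :=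
    ⟨⟨p₀, p₁, p₂, hp₀, hp₁, hp₂, hsum, hlt⟩, rfl, rfl, rfl⟩
  have hgap := DyadicMultifractal.Weights.neg_slopeNeg_lt (P := P)
  refine ⟨P.tau, hμ.lqSpectrum_symmetrize, P.differentiable_tau, P.slopePos, P.slopeNeg,
    DyadicMultifractal.Weights.tendsto_deriv_tau_atTop,
    DyadicMultifractal.Weights.tendsto_deriv_tau_atBot, ?_, hμ.localDims_eq, hgap, ?_,
    fun α hα => hμ.dimH_levelSet hα, ?_⟩
  · rw [hμ.localDims_eq, hμ.localDims_symmetrize]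
  -- The radius is exactly the gap to the interval.
  · refine ⟨-Real.logb 2 P.p₁ - -P.slopeNeg, by linarith, ?_⟩
    rw [hμ.localDims_eq]
    ext α
    constructor
    · rintro ⟨h | h, hb⟩
      · rw [Metric.mem_ball, Real.dist_eq, abs_lt] at hb
        linarith [h.2, hb.1]
      · exact h
    · rintro rfl
      exact ⟨Or.inr rfl, Metric.mem_ball_self (by linarith)⟩
  · rw [hμ.levelSet_neg_logb]
    exact dimH_singleton 1
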